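/- Let $\ell>0$ and let $f\in W^{1,2}(0,\ell)$ be complex-valued (identified with its continuous representative on $[0,\ell]$), with $f(x)\neq 0$ for all $x\in[0,\ell]$ and $f(0)=1$. Let $q_f=f''/f$ denote the distribution $(q_f|\phi)=\int_0^\ell\{(f'/f)^2\phi-(f'/f)\phi'\}$ and let $\mathbf S_f y=-y''+q_f y$ (in the sense of distributions), that is $(\mathbf S_f y|\phi)=\int_0^\ell y'\phi'+(q_f|y\phi)$ for $y\in W^{1,2}(0,\ell)$, and $\mathbf L_f v=-\frac1{f^2}(f^2v')'$ for $v\in W^{2,2}(0,\ell)$. For $\rho\in\mathbb C$ let $e_f(\rho,\cdot)\in W^{1,2}(0,\ell)$ be the solution of $\mathbf S_f y=\rho^2y$ with $y(0)=1$, $\left(y'-\frac{f'}{f}y\right)(0)=i\rho$, and let $\widehat e_f(\rho,\cdot)\in W^{2,2}(0,\ell)$ be the solution of $\mathbf L_f v=\rho^2 v$ with $v(0)=1$, $v'(0)=i\rho$. Put $\mathcal T_\ell=\{(x,t):0\le x\le\ell,\ |t|\le x\}$. Then there exist kernels $K_f,\widehat K_f\in L^2(\mathcal T_\ell)$, with $K_f(x,\cdot)$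 and $\widehat K_f(x,\cdot)$ integrable on $(-x,x)$ for every $x\in(0,\ell]$, such that for all $\rho\in\mathbb C$ and $x\in(0,\ell]$ $$e_f(\rho,x)=e^{i\rho x}+\int_{-x}^xK_f(x,t)e^{i\rho t}\,dt,\qquad \widehat e_f(\rho,x)=e^{i\rho x}-i\rho\int_{-x}^x\widehat K_f(x,t)e^{i\rho t}\,dt .$$ Define $\mathbf T_fv(x)=v(x)+\int_{-x}^xK_f(x,t)v(t)\,dt$ and $\widehat{\mathbf T}_fv(x)=v(x)-\int_{-x}^x\widehat K_f(x,t)v'(t)\,dt$. For any such kernels the following hold. (i) $\widehat{\mathbf T}_fv=\frac1f\mathbf T_fv$ for every $v\in W^{1,2}(-\ell,\ell)$ (almost everywhere on $(0,\ell)$, and at every point of $[0,\ell]$ when $v$ is the continuous representative). (ii) For every $x\in(0,\ell]$, $\widehat K_f(x,\cdot)\in W^{1,2}(-x,x)$ with weak derivative $\frac1{f(x)}K_f(x,\cdot)$; thus $\frac{\partial\widehat K_f(x,t)}{\partial t}=\frac1{f(x)}K_f(x,t)$ a.e. in $\mathcal T_\ell$. (iii) For every $x\in(0,\ell]$ the continuous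 representative of $\widehat K_f(x,\cdot)$ on $[-x,x]$ satisfies $\widehat K_f(x,x)=1-\frac1{f(x)}$ and $\widehat K_f(x,-x)=0$. -/

import Mathlib

open MeasureTheory Set

noncomputable section

namespace Transmutation

/-- Complex-valued test functions: the space of smooth functions with compact support in the
open interval `(a, b)`. -/
def IsTest (a b : ℝ) (φ : ℝ → ℂ) : Prop :=
  ContDiff ℝ (⊤ : ℕ∞) φ ∧ HasCompactSupport φ ∧ tsupport φ ⊆ Ioo a b

/-- `u` belongs to `W^{1,2}(a,b)` and its weak (distributional) derivative is `u'`.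
The predicate only depends on the almost-everywhere classes of `u` and `u'`. -/
structure HasW12Deriv (a b : ℝ) (u u' : ℝ → ℂ) : Prop where
  memLp : MemLp u 2 (volume.restrict (Ioo a b))
  memLp_deriv : MemLp u' 2 (volume.restrict (Ioo a b))
  weak : ∀ φ : ℝ → ℂ, IsTest a b φ →
    ∫ x in Ioo a b, u x * deriv φ x = -∫ x in Ioo a b, u' x * φ x

/-- `c` is the continuous representative on `[a,b]` of the class of `u` on `(a,b)`. -/
def IsContinuousRep (a b : ℝ) (u c : ℝ → ℂ) : Prop :=
  ContinuousOn c (Icc a b) ∧ c =ᵐ[volume.restrict (Ioo a b)] u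

/-- The action on `ψ` (with weak derivative `ψ'`) of the distribution
`q_f = f''/f`, that is `(q_f | ψ) = ∫ (f'/f)² ψ - (f'/f) ψ'`. -/
def potentialPairing (ℓ : ℝ) (f f' : ℝ → ℂ) (ψ ψ' : ℝ → ℂ) : ℂ :=
  ∫ x in Ioo 0 ℓ, ((f' x / f x) ^ 2 * ψ x - (f' x / f x) * ψ' x)

/-- The action on `φ` of the distribution `S_f y = -y'' + q_f y`, that is
`(S_f y | φ) = ∫ y' φ' + (q_f | y φ)`. -/
def schrodingerPairing (ℓ : ℝ) (f f' y y' φ : ℝ → ℂ) : ℂ :=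
  (∫ x in Ioo 0 ℓ, y' x * deriv φ x) +
    potentialPairing ℓ f f' (fun x => y x * φ x) (fun x => y' x * φ x + y x * deriv φ x)

/-- `y = e_f(ρ, ·)`: the solution in `W^{1,2}(0,ℓ)` (given by its continuous representative) of
`S_f y = ρ² y` in the sense of distributions with `y(0) = 1` and `D_f y(0) = iρ`, where
`D_f y = y' - (f'/f) y`; the function `w` is the continuous representative of `D_f y`. -/
def IsSchrodingerExp (ℓ : ℝ) (f f' : ℝ → ℂ) (ρ : ℂ) (y : ℝ → ℂ) : Prop :=
  ∃ y' w : ℝ → ℂ,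
    ContinuousOn y (Icc 0 ℓ) ∧ HasW12Deriv 0 ℓ y y' ∧
    (∀ φ : ℝ → ℂ, IsTest 0 ℓ φ →
      schrodingerPairing ℓ f f' y y' φ = ∫ x in Ioo 0 ℓ, ρ ^ 2 * y x * φ x) ∧
    IsContinuousRep 0 ℓ (fun x => y' x - f' x / f x * y x) w ∧
    y 0 = 1 ∧ w 0 = Complex.I * ρ

/-- The impedance exponential: the solution `v` in `W^{2,2}(0,ℓ)` of
`-(1/f²) (f² v')' = ρ² v` with `v(0) = 1` and `v'(0) = iρ`. -/
def IsImpedanceExp (ℓ : ℝ) (f : ℝ → ℂ) (ρ : ℂ) (v : ℝ → ℂ) : Prop :=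
  ∃ v' v'' : ℝ → ℂ,
    ContinuousOn v (Icc 0 ℓ) ∧ ContinuousOn v' (Icc 0 ℓ) ∧
    HasW12Deriv 0 ℓ v v' ∧ HasW12Deriv 0 ℓ v' v'' ∧
    HasW12Deriv 0 ℓ (fun x => f x ^ 2 * v' x) (fun x => -(f x ^ 2 * (ρ ^ 2 * v x))) ∧
    v 0 = 1 ∧ v' 0 = Complex.I * ρ

/-- The triangle `0 ≤ x ≤ ℓ`, `|t| ≤ x`. -/
def triangle (ℓ : ℝ) : Set (ℝ × ℝ) :=
  {p | 0 ≤ p.1 ∧ p.1 ≤ ℓ ∧ |p.2| ≤ p.1}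

/-- `K` belongs to `L²` of the triangle, and `K(x,·)` is integrable on `(-x,x)` for every `x`,
so that the integrals of `K(x,t) e^{iρt}` over `(-x,x)` are meaningful for every `x`. -/
def IsTriangleKernel (ℓ : ℝ) (K : ℝ → ℝ → ℂ) : Prop :=
  MemLp (Function.uncurry K) 2 (volume.restrict (triangle ℓ)) ∧
    ∀ x ∈ Ioc 0 ℓ, IntervalIntegrable (K x) volume (-x) x

/-- `K = K_f`: the transmutation kernel of the Schrodinger operator, determined by
`e_f(ρ,x) = e^{iρx} + ∫_{-x}^{x} K(x,t) e^{iρt} dt`. -/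
def IsSchrodingerKernel (ℓ : ℝ) (f f' : ℝ → ℂ) (K : ℝ → ℝ → ℂ) : Prop :=
  IsTriangleKernel ℓ K ∧
    ∀ ρ : ℂ, ∃ e : ℝ → ℂ, IsSchrodingerExp ℓ f f' ρ e ∧
      ∀ x ∈ Ioc 0 ℓ, e x = Complex.exp (Complex.I * ρ * x) +
        ∫ t in (-x)..x, K x t * Complex.exp (Complex.I * ρ * t)

/-- `Kh`: the transmutation kernel of the impedance operator, determined by
`ê_f(ρ,x) = e^{iρx} - iρ ∫_{-x}^{x} Kh(x,t) e^{iρt} dt`. -/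
def IsImpedanceKernel (ℓ : ℝ) (f : ℝ → ℂ) (Kh : ℝ → ℝ → ℂ) : Prop :=
  IsTriangleKernel ℓ Kh ∧
    ∀ ρ : ℂ, ∃ e : ℝ → ℂ, IsImpedanceExp ℓ f ρ e ∧
      ∀ x ∈ Ioc 0 ℓ, e x = Complex.exp (Complex.I * ρ * x) -
        Complex.I * ρ * ∫ t in (-x)..x, Kh x t * Complex.exp (Complex.I * ρ * t)

/-- The operator `T_f v (x) = v(x) + ∫_{-x}^{x} K(x,t) v(t) dt`. -/
def schrodingerOp (K : ℝ → ℝ → ℂ) (v : ℝ → ℂ) (x : ℝ) : ℂ :=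
  v x + ∫ t in (-x)..x, K x t * v t

/-- The operator `v ↦ v(x) - ∫_{-x}^{x} Kh(x,t) v'(t) dt`, where `v'` is the weak derivative
of `v`. -/
def impedanceOp (Kh : ℝ → ℝ → ℂ) (v v' : ℝ → ℂ) (x : ℝ) : ℂ :=
  v x - ∫ t in (-x)..x, Kh x t * v' t

end Transmutation

end

/-!
Write `σ = f' / f`. The operator factors as `S_f = -(d/dx + σ)(d/dx - σ)`, so `S_f y = ρ² y` is a
first order system for `y` and its quasi-derivative `y' - σ y`, which in the variables
`y ± (y' - σ y) / (iρ)` becomes `A' = iρ A + σ B`, `B' = -iρ B + σ A`. Integrating along the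
characteristics `x ± t = const` turns this into a Volterra equation whose Neumann series can be
summed before the Fourier transform is taken: every term is the transform of a kernel supported in
`|t| ≤ x`, and their sum is `K`.

The solution of the impedance equation is `ê_f = e_f / f`, and integrating by parts in `t` shows
that the primitive of `K(x, ·) / f(x)` vanishing at `-x` is a kernel `K̂`; its value at `x` is read
off at `ρ = 0`, where `e_f = f`. Since an integrable function on `(-x, x)` is determined by its
exponential moments, every admissible pair of kernels is related in this way.
-/

namespace Transmutation

/-! ### Primitives of integrable functions -/

section Primitive

variable {E : Type*} [NormedAddCommGroup E] [NormedSpace ℝ E] {a b : ℝ}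

/-- `u` is on `[a, b]` a primitive of the integrable function `u'`, that is, `u` is absolutely
continuous with derivative `u'` almost everywhere. -/
structure IsPrimitiveOn (a b : ℝ) (u u' : ℝ → E) : Prop where
  le : a ≤ b
  integrable : IntervalIntegrable u' volume a b
  eq_add_integral : ∀ x ∈ Icc a b, u x = u a + ∫ t in a..x, u' t

theorem absolutelyContinuousOnInterval_of_dist_le {X Y : Type*} [PseudoMetricSpace X]
    [PseudoMetricSpace Y] {g : ℝ → X} {h : ℝ → Y} {C : ℝ}
    (hh : AbsolutelyContinuousOnInterval h a b)
    (hgh : ∀ x ∈ uIcc a b, ∀ y ∈ uIcc a b, dist (g x) (g y) ≤ C * dist (h x) (h y)) :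
    AbsolutelyContinuousOnInterval g a b := by
  have hlim := Filter.Tendsto.const_mul C (show Filter.Tendsto _ _ (nhds 0) from hh)
  rw [mul_zero] at hlim
  refine squeeze_zero' (.of_forall fun E => Finset.sum_nonneg fun _ _ => dist_nonneg) ?_ hlim
  have hdisj : ∀ᶠ E : ℕ × (ℕ → ℝ × ℝ) in AbsolutelyContinuousOnInterval.totalLengthFilter ⊓
      Filter.principal (AbsolutelyContinuousOnInterval.disjWithin a b),
      E ∈ AbsolutelyContinuousOnInterval.disjWithin a b :=
    Filter.eventually_inf_principal.mpr (.of_forall fun _ hE => hE)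
  filter_upwards [hdisj] with E hE
  rw [Finset.mul_sum]
  exact Finset.sum_le_sum fun i hi => hgh _ (hE.1 i hi).1 _ (hE.1 i hi).2

theorem absolutelyContinuousOnInterval_integral {u : ℝ → E}
    (hu : IntervalIntegrable u volume a b) :
    AbsolutelyContinuousOnInterval (fun x => ∫ t in a..x, u t) a b := by
  refine absolutelyContinuousOnInterval_of_dist_le (C := 1)
    (hu.norm.absolutelyContinuousOnInterval_intervalIntegral left_mem_uIcc) fun x hx y hy => ?_
  have hi : ∀ z ∈ uIcc a b, IntervalIntegrable u volume a z := fun z hz =>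
    hu.mono_set (uIcc_subset_uIcc left_mem_uIcc hz)
  rw [dist_eq_norm, Real.dist_eq, one_mul,
    intervalIntegral.integral_interval_sub_left (hi x hx) (hi y hy),
    intervalIntegral.integral_interval_sub_left (hi x hx).norm (hi y hy).norm]
  exact intervalIntegral.norm_integral_le_abs_integral_norm

theorem ae_mem_Ioo_of_mem_uIcc (hab : a ≤ b) : ∀ᵐ x : ℝ, x ∈ uIcc a b → x ∈ Ioo a b := by
  filter_upwards [Measure.ae_ne volume a, Measure.ae_ne volume b] with x ha hb hx
  rw [uIcc_of_le hab] at hx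
  exact ⟨lt_of_le_of_ne hx.1 ha.symm, lt_of_le_of_ne hx.2 hb⟩

namespace IsPrimitiveOn

variable {u u' v v' : ℝ → E}

theorem const_add_integral (hab : a ≤ b) (c : E) (hu' : IntervalIntegrable u' volume a b) :
    IsPrimitiveOn a b (fun x => c + ∫ t in a..x, u' t) u' :=
  ⟨hab, hu', by simp⟩

theorem mono_right (hu : IsPrimitiveOn a b u u') {c : ℝ} (hc : c ∈ Icc a b) :
    IsPrimitiveOn a c u u' :=
  ⟨hc.1, hu.integrable.mono_set (uIcc_subset_uIcc left_mem_uIcc (Icc_subset_uIcc hc)),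
    fun x hx => hu.eq_add_integral x ⟨hx.1, hx.2.trans hc.2⟩⟩

theorem mono (hu : IsPrimitiveOn a b u u') {c d : ℝ} (hac : a ≤ c) (hcd : c ≤ d) (hdb : d ≤ b) :
    IsPrimitiveOn c d u u' := by
  have hint : ∀ x ∈ Icc a b, IntervalIntegrable u' volume a x := fun x hx =>
    (hu.mono_right hx).integrable
  have hc : c ∈ Icc a b := ⟨hac, hcd.trans hdb⟩
  refine ⟨hcd, (hint c hc).symm.trans (hint d ⟨hac.trans hcd, hdb⟩), fun x hx => ?_⟩
  have hx' : x ∈ Icc a b := ⟨hac.trans hx.1, hx.2.trans hdb⟩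
  rw [hu.eq_add_integral x hx', hu.eq_add_integral c hc, add_assoc,
    intervalIntegral.integral_add_adjacent_intervals (hint c hc)
      ((hint c hc).symm.trans (hint x hx'))]

theorem absolutelyContinuous (hu : IsPrimitiveOn a b u u') :
    AbsolutelyContinuousOnInterval u a b := by
  refine absolutelyContinuousOnInterval_of_dist_le (C := 1)
    (absolutelyContinuousOnInterval_integral hu.integrable) fun x hx y hy => ?_
  rw [uIcc_of_le hu.le] at hx hy
  rw [hu.eq_add_integral x hx, hu.eq_add_integral y hy, one_mul, dist_add_left]

theorem continuousOn (hu : IsPrimitiveOn a b u u') : ContinuousOn u (Icc a b) := by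
  simpa only [uIcc_of_le hu.le] using hu.absolutelyContinuous.continuousOn

theorem continuousOn_uIcc (hu : IsPrimitiveOn a b u u') : ContinuousOn u (uIcc a b) :=
  hu.absolutelyContinuous.continuousOn

theorem of_hasDerivAt [CompleteSpace E] (hab : a ≤ b) (hd : ∀ x, HasDerivAt u (u' x) x)
    (hc : Continuous u') : IsPrimitiveOn a b u u' := by
  refine ⟨hab, hc.intervalIntegrable _ _, fun x _ => ?_⟩
  rw [intervalIntegral.integral_eq_sub_of_hasDerivAt (fun y _ => hd y) (hc.intervalIntegrable _ _)]
  abel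

theorem congr (hu : IsPrimitiveOn a b u u') (h : EqOn u v (Icc a b)) :
    IsPrimitiveOn a b v u' :=
  ⟨hu.le, hu.integrable, fun x hx => by
    rw [← h hx, ← h (left_mem_Icc.2 hu.le), hu.eq_add_integral x hx]⟩

theorem congr_deriv (hu : IsPrimitiveOn a b u u') (h : u' =ᵐ[volume.restrict (Ioo a b)] v') :
    IsPrimitiveOn a b u v' := by
  rw [restrict_Ioo_eq_restrict_Ioc] at h
  have hIoc : ∀ᵐ x, x ∈ Ioc a b → u' x = v' x := (ae_restrict_iff' measurableSet_Ioc).1 h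
  refine ⟨hu.le, hu.integrable.congr_ae (by rwa [uIoc_of_le hu.le]), fun x hx => ?_⟩
  rw [hu.eq_add_integral x hx]
  congr 1
  refine intervalIntegral.integral_congr_ae ?_
  filter_upwards [hIoc] with y hy hyx
  rw [uIoc_of_le hx.1] at hyx
  exact hy ⟨hyx.1, hyx.2.trans hx.2⟩

theorem add (hu : IsPrimitiveOn a b u u') (hv : IsPrimitiveOn a b v v') :
    IsPrimitiveOn a b (fun x => u x + v x) (fun x => u' x + v' x) := by
  refine ⟨hu.le, hu.integrable.add hv.integrable, fun x hx => ?_⟩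
  rw [intervalIntegral.integral_add (hu.mono_right hx).integrable (hv.mono_right hx).integrable,
    hu.eq_add_integral x hx, hv.eq_add_integral x hx]
  abel

theorem sub (hu : IsPrimitiveOn a b u u') (hv : IsPrimitiveOn a b v v') :
    IsPrimitiveOn a b (fun x => u x - v x) (fun x => u' x - v' x) := by
  refine ⟨hu.le, hu.integrable.sub hv.integrable, fun x hx => ?_⟩
  rw [intervalIntegral.integral_sub (hu.mono_right hx).integrable (hv.mono_right hx).integrable,
    hu.eq_add_integral x hx, hv.eq_add_integral x hx]
  abel

theorem integral_eq (hu : IsPrimitiveOn a b u u') : ∫ t in a..b, u' t = u b - u a := by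
  rw [hu.eq_add_integral b (right_mem_Icc.2 hu.le), add_sub_cancel_left]

theorem prodMk {F : Type*} [NormedAddCommGroup F] [NormedSpace ℝ F] [CompleteSpace E]
    [CompleteSpace F] {w w' : ℝ → F} (hu : IsPrimitiveOn a b u u') (hw : IsPrimitiveOn a b w w') :
    IsPrimitiveOn a b (fun x => (u x, w x)) (fun x => (u' x, w' x)) := by
  refine ⟨hu.le, intervalIntegrable_iff.2 <|
    (intervalIntegrable_iff.1 hu.integrable).prodMk (intervalIntegrable_iff.1 hw.integrable),
    fun x hx => ?_⟩
  rw [intervalIntegral.integral_of_le hx.1, integral_pair (hu.mono_right hx).integrable.1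
    (hw.mono_right hx).integrable.1, ← intervalIntegral.integral_of_le hx.1,
    ← intervalIntegral.integral_of_le hx.1, hu.eq_add_integral x hx, hw.eq_add_integral x hx,
    Prod.mk_add_mk]

variable [CompleteSpace E]

theorem ae_hasDerivAt (hu : IsPrimitiveOn a b u u') :
    ∀ᵐ x ∂volume.restrict (Ioo a b), HasDerivAt u (u' x) x := by
  refine (ae_restrict_iff' measurableSet_Ioo).2 ?_
  filter_upwards [hu.integrable.ae_hasDerivAt_integral] with x hx hxab
  refine ((hx (Icc_subset_uIcc (Ioo_subset_Icc_self hxab)) a left_mem_uIcc).const_add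
    (u a)).congr_of_eventuallyEq ?_
  filter_upwards [Ioo_mem_nhds hxab.1 hxab.2] with y hy
  exact hu.eq_add_integral y (Ioo_subset_Icc_self hy)

theorem of_absolutelyContinuous (hab : a ≤ b) (hu : AbsolutelyContinuousOnInterval u a b)
    (hu' : IntervalIntegrable u' volume a b)
    (hd : ∀ᵐ x ∂volume.restrict (Ioo a b), HasDerivAt u (u' x) x) : IsPrimitiveOn a b u u' := by
  have hdiff : ∀ᵐ x, x ∈ uIcc a b → HasDerivAt (u - fun x => ∫ t in a..x, u' t) 0 x := by
    filter_upwards [(ae_restrict_iff' measurableSet_Ioo).1 hd, hu'.ae_hasDerivAt_integral,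
      ae_mem_Ioo_of_mem_uIcc hab] with x hxu hxi hxab hx
    simpa using (hxu (hxab hx)).sub (hxi hx a left_mem_uIcc)
  obtain ⟨C, hC⟩ :=
    (hu.sub (absolutelyContinuousOnInterval_integral hu')).const_of_ae_hasDerivAt_zero hdiff
  refine ⟨hab, hu', fun x hx => ?_⟩
  have hCx := hC x (Icc_subset_uIcc hx)
  have hCa := hC a left_mem_uIcc
  simp only [Pi.sub_apply, intervalIntegral.integral_same, sub_zero] at hCx hCa
  rw [hCa, ← hCx, sub_add_cancel]

end IsPrimitiveOn

namespace IsPrimitiveOn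

section Algebra

variable {𝕜 : Type*} [RCLike 𝕜] {u u' v v' : ℝ → 𝕜}

theorem const_mul (c : 𝕜) (hu : IsPrimitiveOn a b u u') :
    IsPrimitiveOn a b (fun x => c * u x) (fun x => c * u' x) := by
  refine ⟨hu.le, hu.integrable.const_mul c, fun x hx => ?_⟩
  rw [intervalIntegral.integral_const_mul, hu.eq_add_integral x hx, mul_add]

theorem mul (hu : IsPrimitiveOn a b u u') (hv : IsPrimitiveOn a b v v') :
    IsPrimitiveOn a b (fun x => u x * v x) (fun x => u' x * v x + u x * v' x) := by
  refine of_absolutelyContinuous hu.le (hu.absolutelyContinuous.smul hv.absolutelyContinuous)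
    ((hu.integrable.mul_continuousOn hv.continuousOn_uIcc).add
      (hv.integrable.continuousOn_mul hu.continuousOn_uIcc)) ?_
  filter_upwards [hu.ae_hasDerivAt, hv.ae_hasDerivAt] with x hux hvx
  exact hux.mul hvx

theorem integral_mul_eq (hu : IsPrimitiveOn a b u u') (hv : IsPrimitiveOn a b v v') :
    ∫ t in a..b, u t * v' t = u b * v b - u a * v a - ∫ t in a..b, u' t * v t := by
  rw [← (hu.mul hv).integral_eq, intervalIntegral.integral_add
    (hu.integrable.mul_continuousOn hv.continuousOn_uIcc)
    (hv.integrable.continuousOn_mul hu.continuousOn_uIcc), add_sub_cancel_left]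

end Algebra

section Composition

variable {𝕜 F : Type*} [RCLike 𝕜] [NormedAddCommGroup F] [NormedSpace ℝ F] [NormedSpace 𝕜 F]
  {u u' : ℝ → 𝕜}

theorem comp [IsScalarTower ℝ 𝕜 F] [CompleteSpace F] {φ : 𝕜 → F} (hu : IsPrimitiveOn a b u u')
    (hφ : ∀ x ∈ Icc a b, ContDiffAt 𝕜 1 φ (u x)) :
    IsPrimitiveOn a b (fun x => φ (u x)) (fun x => u' x • deriv φ (u x)) := by
  have hlip : LocallyLipschitzOn (u '' Icc a b) φ := by
    rintro _ ⟨x, hx, rfl⟩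
    obtain ⟨K, t, ht, hK⟩ := (hφ x hx).exists_lipschitzOnWith
    exact ⟨K, t, mem_nhdsWithin_of_mem_nhds ht, hK⟩
  obtain ⟨K, hK⟩ :=
    hlip.exists_lipschitzOnWith_of_compact (isCompact_Icc.image_of_continuousOn hu.continuousOn)
  have hcont : ContinuousOn (fun x => deriv φ (u x)) (uIcc a b) := by
    intro x hx
    have hφx := hφ x (by rwa [uIcc_of_le hu.le] at hx)
    exact (hφx.derivWithin (m := 0) le_rfl).continuousAt.comp_continuousWithinAt
      (hu.continuousOn_uIcc x hx)
  refine of_absolutelyContinuous hu.le (absolutelyContinuousOnInterval_of_dist_le (C := K)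
    hu.absolutelyContinuous fun x hx y hy => ?_) (hu.integrable.smul_continuousOn hcont) ?_
  · rw [uIcc_of_le hu.le] at hx hy
    exact hK.dist_le_mul _ (mem_image_of_mem u hx) _ (mem_image_of_mem u hy)
  · filter_upwards [hu.ae_hasDerivAt, ae_restrict_mem measurableSet_Ioo] with x hux hx
    exact ((hφ x (Ioo_subset_Icc_self hx)).differentiableAt one_ne_zero).hasDerivAt.scomp x hux

theorem inv (hu : IsPrimitiveOn a b u u') (h0 : ∀ x ∈ Icc a b, u x ≠ 0) :
    IsPrimitiveOn a b (fun x => (u x)⁻¹) (fun x => -u' x / u x ^ 2) := by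
  refine (hu.comp (φ := Inv.inv) fun x hx => contDiffAt_inv 𝕜 (h0 x hx)).congr_deriv
    (.of_forall fun x => ?_)
  simp only [deriv_inv, smul_eq_mul]
  ring

end Composition

theorem exp {u u' : ℝ → ℝ} (hu : IsPrimitiveOn a b u u') :
    IsPrimitiveOn a b (fun x => Real.exp (u x)) (fun x => u' x * Real.exp (u x)) := by
  simpa only [Real.deriv_exp, smul_eq_mul] using
    hu.comp (φ := Real.exp) fun x _ => Real.contDiff_exp.contDiffAt

theorem le_of_deriv_nonpos {u u' : ℝ → ℝ} (hu : IsPrimitiveOn a b u u')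
    (h : ∀ᵐ x ∂volume.restrict (Ioo a b), u' x ≤ 0) {x : ℝ} (hx : x ∈ Icc a b) : u x ≤ u a := by
  rw [hu.eq_add_integral x hx, intervalIntegral.integral_of_le hx.1,
    ← restrict_Ioo_eq_restrict_Ioc, add_le_iff_nonpos_right]
  exact integral_nonpos_of_ae
    (ae_restrict_of_ae_restrict_of_subset (Ioo_subset_Ioo_right hx.2) h)

theorem norm_le_add {u u' : ℝ → E} {g g' : ℝ → ℝ} (hu : IsPrimitiveOn a b u u')
    (hg : IsPrimitiveOn a b g g') (h : ∀ᵐ x ∂volume.restrict (Ioo a b), ‖u' x‖ ≤ g' x) {x : ℝ}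
    (hx : x ∈ Icc a b) : ‖u x‖ ≤ ‖u a‖ + (g x - g a) := by
  rw [hu.eq_add_integral x hx, hg.eq_add_integral x hx, add_sub_cancel_left]
  refine (norm_add_le _ _).trans (add_le_add_right ?_ _)
  refine intervalIntegral.norm_integral_le_of_norm_le hx.1 ?_ (hg.mono_right hx).integrable
  rw [restrict_Ioo_eq_restrict_Ioc, ae_restrict_iff' measurableSet_Ioc] at h
  filter_upwards [h] with t ht htx using ht ⟨htx.1, htx.2.trans hx.2⟩

/-- Grönwall's inequality for an integrable weight: if `G` is the primitive of `k ‖u‖` vanishing at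
`a` and `F` that of `k`, then `‖u‖ ≤ G`, so `G e^{-F}` decreases. -/
theorem eqOn_zero_of_norm_le {u u' : ℝ → E} {k : ℝ → ℝ} (hu : IsPrimitiveOn a b u u')
    (ha : u a = 0) (hk : IntervalIntegrable k volume a b)
    (hk0 : ∀ᵐ x ∂volume.restrict (Ioo a b), 0 ≤ k x)
    (hle : ∀ᵐ x ∂volume.restrict (Ioo a b), ‖u' x‖ ≤ k x * ‖u x‖) : EqOn u 0 (Icc a b) := by
  have hF : IsPrimitiveOn a b (fun x => 0 + ∫ t in a..x, -k t) fun x => -k x :=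
    const_add_integral hu.le 0 hk.neg
  have hG : IsPrimitiveOn a b (fun x => 0 + ∫ t in a..x, k t * ‖u t‖) fun x => k x * ‖u x‖ :=
    const_add_integral hu.le 0 (hk.mul_continuousOn hu.continuousOn_uIcc.norm)
  set F := fun x => 0 + ∫ t in a..x, -k t
  set G := fun x => 0 + ∫ t in a..x, k t * ‖u t‖
  have hGa : G a = 0 := by simp [G]
  have huG : ∀ x ∈ Icc a b, ‖u x‖ ≤ G x := fun x hx => by
    simpa only [ha, norm_zero, zero_add, hGa, sub_zero] using hu.norm_le_add hG hle hx
  have hdecr : ∀ᵐ x ∂volume.restrict (Ioo a b),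
      k x * ‖u x‖ * Real.exp (F x) + G x * (-k x * Real.exp (F x)) ≤ 0 := by
    filter_upwards [hk0, ae_restrict_mem measurableSet_Ioo] with x hkx hx
    rw [show k x * ‖u x‖ * Real.exp (F x) + G x * (-k x * Real.exp (F x)) =
      -(k x * Real.exp (F x) * (G x - ‖u x‖)) by ring, neg_nonpos]
    exact mul_nonneg (mul_nonneg hkx (Real.exp_nonneg _))
      (sub_nonneg.2 (huG x (Ioo_subset_Icc_self hx)))
  intro x hx
  have hGx : G x ≤ 0 := by
    have hGF := (hG.mul hF.exp).le_of_deriv_nonpos hdecr hx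
    rw [hGa, zero_mul] at hGF
    exact nonpos_of_mul_nonpos_left hGF (Real.exp_pos _)
  exact norm_le_zero_iff.1 ((huG x hx).trans hGx)

end IsPrimitiveOn

end Primitive

/-! ### Weak derivatives -/

section WeakDerivative

theorem integral_Ioo_eq_intervalIntegral {E : Type*} [NormedAddCommGroup E] [NormedSpace ℝ E]
    {a b : ℝ} (hab : a ≤ b) (g : ℝ → E) : ∫ x in Ioo a b, g x = ∫ x in a..b, g x := by
  rw [intervalIntegral.integral_of_le hab, integral_Ioc_eq_integral_Ioo]

variable {a b : ℝ}

namespace IsTest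

variable {φ ψ : ℝ → ℂ}

theorem isPrimitiveOn (hφ : IsTest a b φ) (hab : a ≤ b) : IsPrimitiveOn a b φ (deriv φ) :=
  .of_hasDerivAt hab (fun x => (hφ.1.differentiable (by simp) x).hasDerivAt)
    (hφ.1.continuous_deriv (by simp))

theorem continuousOn (hφ : IsTest a b φ) (s : Set ℝ) : ContinuousOn φ s :=
  hφ.1.continuous.continuousOn

theorem continuousOn_deriv (hφ : IsTest a b φ) (s : Set ℝ) : ContinuousOn (deriv φ) s :=
  (hφ.1.continuous_deriv (by simp)).continuousOn

theorem eq_zero_of_notMem (hφ : IsTest a b φ) {x : ℝ} (hx : x ∉ Ioo a b) : φ x = 0 :=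
  image_eq_zero_of_notMem_tsupport fun h => hx (hφ.2.2 h)

theorem ofReal {η : ℝ → ℝ} (hη : ContDiff ℝ (⊤ : ℕ∞) η) (hc : HasCompactSupport η)
    (hs : tsupport η ⊆ Ioo a b) : IsTest a b fun x => (η x : ℂ) := by
  have hsupp : tsupport (fun x => (η x : ℂ)) = tsupport η := by
    simp only [tsupport, Function.support, ne_eq, Complex.ofReal_eq_zero]
  exact ⟨Complex.ofRealCLM.contDiff.comp hη, by rwa [HasCompactSupport, hsupp], by rwa [hsupp]⟩

theorem sub_const_mul (hφ : IsTest a b φ) (hψ : IsTest a b ψ) (c : ℂ) :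
    IsTest a b fun x => φ x - c * ψ x :=
  ⟨hφ.1.sub (contDiff_const.mul hψ.1), hφ.2.1.sub hψ.2.1.mul_left,
    (tsupport_sub _ _).trans (union_subset hφ.2.2
      ((tsupport_mul_subset_right (f := fun _ => c)).trans hψ.2.2))⟩

theorem exists_tsupport_subset_Icc (hψ : IsTest a b ψ) :
    ∃ c d, a < c ∧ d < b ∧ tsupport ψ ⊆ Icc c d := by
  rcases (tsupport ψ).eq_empty_or_nonempty with hempty | hne
  · exact ⟨a + 1, b - 1, by linarith, by linarith, by simp [hempty]⟩
  · obtain ⟨c, hc, hcmin⟩ := hψ.2.1.isCompact.exists_isLeast hne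
    obtain ⟨d, hd, hdmax⟩ := hψ.2.1.isCompact.exists_isGreatest hne
    exact ⟨c, d, (hψ.2.2 hc).1, (hψ.2.2 hd).2, fun x hx => ⟨hcmin hx, hdmax hx⟩⟩

end IsTest

theorem support_integral_subset_Icc {ψ : ℝ → ℂ} {c d : ℝ} (hψ : Continuous ψ)
    (hsupp : Function.support ψ ⊆ Icc c d) (hac : a < c) (hdb : d < b)
    (h0 : ∫ x in a..b, ψ x = 0) : Function.support (fun x => ∫ t in a..x, ψ t) ⊆ Icc c d := by
  have hzero : ∀ {p q : ℝ}, (∀ t ∈ uIcc p q, t ∉ Icc c d) → ∫ t in p..q, ψ t = 0 := by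
    intro p q h
    rw [intervalIntegral.integral_congr (g := fun _ => 0) fun t ht =>
      Function.notMem_support.1 fun hts => h t ht (hsupp hts), intervalIntegral.integral_zero]
  intro x hx
  by_contra hxcd
  rw [mem_Icc, not_and_or, not_le, not_le] at hxcd
  rcases hxcd with hxc | hdx
  · refine hx (hzero fun t ht htcd => ?_)
    rcases mem_uIcc.1 ht with h | h <;> linarith [htcd.1, h.1, h.2]
  · have hsplit := intervalIntegral.integral_add_adjacent_intervals
      (hψ.intervalIntegrable (μ := volume) a x) (hψ.intervalIntegrable x b)
    rw [h0, hzero (p := x) (q := b), add_zero] at hsplit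
    · exact hx hsplit
    · intro t ht htcd
      rcases mem_uIcc.1 ht with h | h <;> linarith [htcd.2, h.1, h.2]

theorem IsTest.exists_deriv_eq {ψ : ℝ → ℂ} (hψ : IsTest a b ψ) (h0 : ∫ x in a..b, ψ x = 0) :
    ∃ φ, IsTest a b φ ∧ deriv φ = ψ := by
  have hψc := hψ.1.continuous
  have hderiv : ∀ x, HasDerivAt (fun x => ∫ t in a..x, ψ t) (ψ x) x := fun x =>
    intervalIntegral.integral_hasDerivAt_right (hψc.intervalIntegrable _ _)
      (hψc.stronglyMeasurableAtFilter _ _) hψc.continuousAt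
  have hderiv_eq : deriv (fun x => ∫ t in a..x, ψ t) = ψ := funext fun x => (hderiv x).deriv
  obtain ⟨c, d, hac, hdb, hcd⟩ := hψ.exists_tsupport_subset_Icc
  have hsupp := support_integral_subset_Icc hψc ((subset_tsupport ψ).trans hcd) hac hdb h0
  refine ⟨_, ⟨contDiff_infty_iff_deriv.2 ⟨fun x => (hderiv x).differentiableAt, ?_⟩,
    .of_support_subset_isCompact isCompact_Icc hsupp,
    (closure_minimal hsupp isClosed_Icc).trans (Icc_subset_Ioo hac hdb)⟩, hderiv_eq⟩
  rw [hderiv_eq]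
  exact hψ.1

theorem exists_isTest_integral_eq_one (hab : a < b) :
    ∃ η, IsTest a b η ∧ ∫ x in a..b, η x = 1 := by
  let B : ContDiffBump ((a + b) / 2) := ⟨(b - a) / 8, (b - a) / 4, by linarith, by linarith⟩
  have hs : tsupport (B.normed volume) ⊆ Ioo a b := by
    rw [B.tsupport_normed_eq, Real.closedBall_eq_Icc]
    exact Icc_subset_Ioo (by simp only [B]; linarith) (by simp only [B]; linarith)
  refine ⟨_, .ofReal B.contDiff_normed B.hasCompactSupport_normed hs, ?_⟩
  rw [intervalIntegral.integral_ofReal, intervalIntegral.integral_of_le hab.le,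
    setIntegral_eq_integral_of_forall_compl_eq_zero fun x hx =>
      image_eq_zero_of_notMem_tsupport fun h => hx (Ioo_subset_Ioc_self (hs h)),
    B.integral_normed, Complex.ofReal_one]

theorem IsPrimitiveOn.weak {u u' φ : ℝ → ℂ} (hu : IsPrimitiveOn a b u u') (hφ : IsTest a b φ) :
    ∫ x in Ioo a b, u x * deriv φ x = -∫ x in Ioo a b, u' x * φ x := by
  rw [integral_Ioo_eq_intervalIntegral hu.le, integral_Ioo_eq_intervalIntegral hu.le,
    hu.integral_mul_eq (hφ.isPrimitiveOn hu.le), hφ.eq_zero_of_notMem (x := a) (by simp),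
    hφ.eq_zero_of_notMem (x := b) (by simp), mul_zero, mul_zero, sub_zero, zero_sub]

/-- The test function `ψ - (∫ ψ) η` has mean zero, hence is the derivative of a test function. -/
theorem integral_mul_eq_of_integral_mul_deriv_eq_zero {g η ψ : ℝ → ℂ}
    (hg : IntervalIntegrable g volume a b)
    (h : ∀ φ, IsTest a b φ → ∫ x in a..b, g x * deriv φ x = 0) (hη : IsTest a b η)
    (hη1 : ∫ x in a..b, η x = 1) (hψ : IsTest a b ψ) :
    ∫ x in a..b, g x * ψ x = (∫ x in a..b, ψ x) * ∫ x in a..b, g x * η x := by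
  have hint : ∀ {χ}, IsTest a b χ → IntervalIntegrable χ volume a b := fun hχ =>
    hχ.1.continuous.intervalIntegrable _ _
  obtain ⟨φ, hφ, hφ'⟩ := (hψ.sub_const_mul hη (∫ x in a..b, ψ x)).exists_deriv_eq (by
    rw [intervalIntegral.integral_sub (hint hψ) ((hint hη).const_mul _),
      intervalIntegral.integral_const_mul, hη1, mul_one, sub_self])
  have hzero := h φ hφ
  simp only [hφ', mul_sub, mul_left_comm (g _)] at hzero
  rwa [intervalIntegral.integral_sub (hg.mul_continuousOn (hψ.continuousOn _))
    ((hg.mul_continuousOn (hη.continuousOn _)).const_mul _),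
    intervalIntegral.integral_const_mul, sub_eq_zero] at hzero

theorem exists_ae_eq_const_of_integral_mul_deriv_eq_zero (hab : a < b) {g : ℝ → ℂ}
    (hg : IntervalIntegrable g volume a b)
    (h : ∀ φ, IsTest a b φ → ∫ x in a..b, g x * deriv φ x = 0) :
    ∃ c : ℂ, g =ᵐ[volume.restrict (Ioo a b)] fun _ => c := by
  obtain ⟨η, hη, hη1⟩ := exists_isTest_integral_eq_one hab
  set c := ∫ x in a..b, g x * η x with hc
  refine ⟨c, (ae_restrict_iff' measurableSet_Ioo).2 ?_⟩
  have hloc : LocallyIntegrableOn (fun x => g x - c) (Ioo a b) :=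
    ((intervalIntegrable_iff_integrableOn_Ioo_of_le hab.le).1
      (hg.sub intervalIntegrable_const)).locallyIntegrableOn
  have hae := isOpen_Ioo.ae_eq_zero_of_integral_contDiff_smul_eq_zero hloc fun ψ hψ hψc hψs => ?_
  · filter_upwards [hae] with x hx hxab using sub_eq_zero.1 (hx hxab)
  have hψt := IsTest.ofReal hψ hψc hψs
  have hψ0 : ∀ x ∉ Ioc a b, ψ x • (g x - c) = 0 := fun x hx => by
    rw [image_eq_zero_of_notMem_tsupport fun hxs => hx (Ioo_subset_Ioc_self (hψs hxs)), zero_smul]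
  rw [← setIntegral_eq_integral_of_forall_compl_eq_zero hψ0,
    ← intervalIntegral.integral_of_le hab.le]
  simp only [Complex.real_smul, mul_comm ((ψ _ : ℝ) : ℂ), sub_mul]
  rw [intervalIntegral.integral_sub (hg.mul_continuousOn (hψt.continuousOn _))
    ((hψt.1.continuous.intervalIntegrable _ _).const_mul c), intervalIntegral.integral_const_mul,
    integral_mul_eq_of_integral_mul_deriv_eq_zero hg h hη hη1 hψt, ← hc, mul_comm, sub_self]

/-- The lemma of du Bois-Reymond. -/
theorem exists_ae_eq_const_add_integral_of_weak (hab : a < b) {u u' : ℝ → ℂ}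
    (hu : IntervalIntegrable u volume a b) (hu' : IntervalIntegrable u' volume a b)
    (hw : ∀ φ, IsTest a b φ → ∫ x in Ioo a b, u x * deriv φ x = -∫ x in Ioo a b, u' x * φ x) :
    ∃ c : ℂ, u =ᵐ[volume.restrict (Ioo a b)] fun x => c + ∫ t in a..x, u' t := by
  have hP := IsPrimitiveOn.const_add_integral hab.le 0 hu'
  simp only [zero_add] at hP
  have hPi := hP.continuousOn_uIcc.intervalIntegrable (μ := volume)
  obtain ⟨c, hc⟩ := exists_ae_eq_const_of_integral_mul_deriv_eq_zero hab (hu.sub hPi)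
    fun φ hφ => by
      simp only [sub_mul]
      rw [intervalIntegral.integral_sub (hu.mul_continuousOn (hφ.continuousOn_deriv _))
        (hPi.mul_continuousOn (hφ.continuousOn_deriv _)), sub_eq_zero,
        ← integral_Ioo_eq_intervalIntegral hab.le, ← integral_Ioo_eq_intervalIntegral hab.le,
        hw φ hφ, hP.weak hφ]
  refine ⟨c, ?_⟩
  filter_upwards [hc] with x hx using sub_eq_iff_eq_add.1 hx

theorem eqOn_Icc_of_ae_eq_Ioo {E : Type*} [TopologicalSpace E] [T2Space E] {u v : ℝ → E}
    (hab : a < b) (hu : ContinuousOn u (Icc a b)) (hv : ContinuousOn v (Icc a b))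
    (h : u =ᵐ[volume.restrict (Ioo a b)] v) : EqOn u v (Icc a b) := by
  rw [restrict_Ioo_eq_restrict_Icc] at h
  exact Measure.eqOn_Icc_of_ae_eq volume hab.ne h hu hv

theorem isPrimitiveOn_of_weak (hab : a < b) {u u' : ℝ → ℂ} (hu : ContinuousOn u (Icc a b))
    (hu' : IntervalIntegrable u' volume a b)
    (hw : ∀ φ, IsTest a b φ → ∫ x in Ioo a b, u x * deriv φ x = -∫ x in Ioo a b, u' x * φ x) :
    IsPrimitiveOn a b u u' := by
  obtain ⟨c, hc⟩ := exists_ae_eq_const_add_integral_of_weak hab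
    (hu.intervalIntegrable_of_Icc hab.le) hu' hw
  have hP := IsPrimitiveOn.const_add_integral hab.le c hu'
  exact hP.congr (eqOn_Icc_of_ae_eq_Ioo hab hu hP.continuousOn hc).symm

end WeakDerivative

/-! ### Square integrable functions on an interval -/

section SquareIntegrable

variable {a b : ℝ}

theorem intervalIntegrable_of_memLp_two {E : Type*} [NormedAddCommGroup E] {u : ℝ → E}
    (hab : a ≤ b) (hu : MemLp u 2 (volume.restrict (Ioo a b))) :
    IntervalIntegrable u volume a b :=
  (intervalIntegrable_iff_integrableOn_Ioo_of_le hab).2 (hu.integrable one_le_two)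

theorem memLp_of_continuousOn_Icc {E : Type*} [NormedAddCommGroup E] {u : ℝ → E}
    (hu : ContinuousOn u (Icc a b)) (p : ENNReal) : MemLp u p (volume.restrict (Ioo a b)) := by
  obtain ⟨C, hC⟩ := isCompact_Icc.exists_bound_of_continuousOn hu
  refine .of_bound ((hu.mono Ioo_subset_Icc_self).aestronglyMeasurable measurableSet_Ioo) C ?_
  filter_upwards [ae_restrict_mem measurableSet_Ioo] with x hx
  exact hC x (Ioo_subset_Icc_self hx)

theorem memLp_mul_continuousOn {R : Type*} [NormedRing R] {u v : ℝ → R} {p : ENNReal}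
    (hu : MemLp u p (volume.restrict (Ioo a b))) (hv : ContinuousOn v (Icc a b)) :
    MemLp (fun x => u x * v x) p (volume.restrict (Ioo a b)) :=
  (memLp_of_continuousOn_Icc hv ⊤).mul hu

theorem HasW12Deriv.isPrimitiveOn {u u' : ℝ → ℂ} (h : HasW12Deriv a b u u') (hab : a < b)
    (hc : ContinuousOn u (Icc a b)) : IsPrimitiveOn a b u u' :=
  isPrimitiveOn_of_weak hab hc (intervalIntegrable_of_memLp_two hab.le h.memLp_deriv) h.weak

theorem HasW12Deriv.exists_isPrimitiveOn {u u' : ℝ → ℂ} (h : HasW12Deriv a b u u') (hab : a < b) :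
    ∃ v, IsPrimitiveOn a b v u' ∧ u =ᵐ[volume.restrict (Ioo a b)] v := by
  have hu' := intervalIntegrable_of_memLp_two hab.le h.memLp_deriv
  obtain ⟨c, hc⟩ := exists_ae_eq_const_add_integral_of_weak hab
    (intervalIntegrable_of_memLp_two hab.le h.memLp) hu' h.weak
  exact ⟨_, .const_add_integral hab.le c hu', hc⟩

theorem HasW12Deriv.congr {u v u' : ℝ → ℂ} (h : HasW12Deriv a b u u')
    (huv : u =ᵐ[volume.restrict (Ioo a b)] v) : HasW12Deriv a b v u' := by
  refine ⟨h.memLp.ae_eq huv, h.memLp_deriv, fun φ hφ => (integral_congr_ae ?_).trans (h.weak φ hφ)⟩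
  filter_upwards [huv] with x hx
  rw [hx]

theorem IsPrimitiveOn.hasW12Deriv {u u' : ℝ → ℂ} (h : IsPrimitiveOn a b u u')
    (hu' : MemLp u' 2 (volume.restrict (Ioo a b))) : HasW12Deriv a b u u' :=
  ⟨memLp_of_continuousOn_Icc h.continuousOn 2, hu', fun _ => h.weak⟩

end SquareIntegrable

/-! ### First order systems -/

section Systems

theorem IsPrimitiveOn.eqOn_zero_of_coupled {a b : ℝ} {u w p q : ℝ → ℂ}
    (hu : IsPrimitiveOn a b u fun x => p x * w x) (hw : IsPrimitiveOn a b w fun x => q x * u x)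
    (hp : IntervalIntegrable p volume a b) (hq : IntervalIntegrable q volume a b)
    (hua : u a = 0) (hwa : w a = 0) : EqOn u 0 (Icc a b) := by
  have hpair := (hu.prodMk hw).eqOn_zero_of_norm_le (k := fun x => ‖p x‖ + ‖q x‖)
    (by rw [hua, hwa, Prod.mk_zero_zero]) (hp.norm.add hq.norm)
    (.of_forall fun x => by positivity) (.of_forall fun x => ?_)
  · exact fun x hx => congrArg Prod.fst (hpair hx)
  rw [Prod.norm_def, norm_mul, norm_mul]
  exact max_le
    (mul_le_mul (le_add_of_nonneg_right (norm_nonneg _)) (norm_snd_le (u x, w x)) (norm_nonneg _)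
      (by positivity))
    (mul_le_mul (le_add_of_nonneg_left (norm_nonneg _)) (norm_fst_le (u x, w x)) (norm_nonneg _)
      (by positivity))

/-- The equation `-(1/f²) (f² v')' = ρ² v` with the initial values of the impedance exponential,
as a first order system for `v` and `W = f² v'`. The value of `W` at `0` presumes `f 0 = 1`. -/
structure IsImpedanceSystem (ℓ : ℝ) (f : ℝ → ℂ) (ρ : ℂ) (v W : ℝ → ℂ) : Prop where
  fst : IsPrimitiveOn 0 ℓ v fun x => W x / f x ^ 2
  snd : IsPrimitiveOn 0 ℓ W fun x => -(f x ^ 2 * (ρ ^ 2 * v x))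
  fst_zero : v 0 = 1
  snd_zero : W 0 = Complex.I * ρ

/-- The equation `S_f y = ρ² y` with the initial values of the Schrödinger exponential, as a first
order system for `y` and `w = y' - σ y`, where `σ` stands for `f'/f`: it is the factorization
`S_f = -(D + σ) (D - σ)`. -/
structure IsSchrodingerSystem (ℓ : ℝ) (σ : ℝ → ℂ) (ρ : ℂ) (y w : ℝ → ℂ) : Prop where
  fst : IsPrimitiveOn 0 ℓ y fun x => σ x * y x + w x
  snd : IsPrimitiveOn 0 ℓ w fun x => -(σ x * w x) - ρ ^ 2 * y x
  fst_zero : y 0 = 1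
  snd_zero : w 0 = Complex.I * ρ

variable {ℓ : ℝ} {f f' : ℝ → ℂ} {ρ : ℂ}

theorem IsImpedanceSystem.eqOn (hfc : ContinuousOn f (Icc 0 ℓ)) (hf_ne : ∀ x ∈ Icc 0 ℓ, f x ≠ 0)
    {v₁ W₁ v₂ W₂ : ℝ → ℂ} (h₁ : IsImpedanceSystem ℓ f ρ v₁ W₁)
    (h₂ : IsImpedanceSystem ℓ f ρ v₂ W₂) : EqOn v₁ v₂ (Icc 0 ℓ) := by
  have hf2 : ContinuousOn (fun x => f x ^ 2) (Icc 0 ℓ) := hfc.pow 2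
  have hv : IsPrimitiveOn 0 ℓ (fun x => v₁ x - v₂ x) fun x => (f x ^ 2)⁻¹ * (W₁ x - W₂ x) :=
    (h₁.fst.sub h₂.fst).congr_deriv (.of_forall fun x => by ring)
  have hW : IsPrimitiveOn 0 ℓ (fun x => W₁ x - W₂ x) fun x => -(f x ^ 2 * ρ ^ 2) * (v₁ x - v₂ x) :=
    (h₁.snd.sub h₂.snd).congr_deriv (.of_forall fun x => by ring)
  have hzero := hv.eqOn_zero_of_coupled hW
    ((hf2.inv₀ fun x hx => pow_ne_zero 2 (hf_ne x hx)).intervalIntegrable_of_Icc hv.le)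
    ((hf2.mul continuousOn_const).neg.intervalIntegrable_of_Icc hv.le)
    (by rw [h₁.fst_zero, h₂.fst_zero, sub_self]) (by rw [h₁.snd_zero, h₂.snd_zero, sub_self])
  exact fun x hx => sub_eq_zero.1 (hzero hx)

theorem memLp_logDeriv (hf' : MemLp f' 2 (volume.restrict (Ioo 0 ℓ)))
    (hfc : ContinuousOn f (Icc 0 ℓ)) (hf_ne : ∀ x ∈ Icc 0 ℓ, f x ≠ 0) :
    MemLp (fun x => f' x / f x) 2 (volume.restrict (Ioo 0 ℓ)) := by
  simp only [div_eq_mul_inv]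
  exact memLp_mul_continuousOn hf' (hfc.inv₀ hf_ne)

theorem IsImpedanceExp.exists_isImpedanceSystem (hℓ : 0 < ℓ) (hfc : ContinuousOn f (Icc 0 ℓ))
    (hf_ne : ∀ x ∈ Icc 0 ℓ, f x ≠ 0) (hf_zero : f 0 = 1) {v : ℝ → ℂ}
    (h : IsImpedanceExp ℓ f ρ v) : ∃ W, IsImpedanceSystem ℓ f ρ v W := by
  obtain ⟨v', v'', hvc, hvc', hv, -, hfv', hv0, hv0'⟩ := h
  refine ⟨fun x => f x ^ 2 * v' x, ?_, hfv'.isPrimitiveOn hℓ ((hfc.pow 2).mul hvc'), hv0,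
    by rw [hf_zero, hv0', one_pow, one_mul]⟩
  refine (hv.isPrimitiveOn hℓ hvc).congr_deriv ?_
  filter_upwards [ae_restrict_mem measurableSet_Ioo] with x hx
  rw [mul_div_cancel_left₀ _ (pow_ne_zero 2 (hf_ne x (Ioo_subset_Icc_self hx)))]

theorem IsImpedanceSystem.hasW12Deriv_div (hf : IsPrimitiveOn 0 ℓ f f')
    (hf' : MemLp f' 2 (volume.restrict (Ioo 0 ℓ))) (hf_ne : ∀ x ∈ Icc 0 ℓ, f x ≠ 0)
    {v W : ℝ → ℂ} (h : IsImpedanceSystem ℓ f ρ v W) :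
    HasW12Deriv 0 ℓ (fun x => W x / f x ^ 2)
      fun x => -(ρ ^ 2 * v x) + f' x * (-2 * W x / f x ^ 3) := by
  have hne : ∀ n, ∀ x ∈ Icc 0 ℓ, f x ^ n ≠ 0 := fun n x hx => pow_ne_zero n (hf_ne x hx)
  have hprim : IsPrimitiveOn 0 ℓ (fun x => W x / f x ^ 2)
      fun x => -(ρ ^ 2 * v x) + f' x * (-2 * W x / f x ^ 3) := by
    refine ((h.snd.mul ((hf.mul hf).inv fun x hx => ?_)).congr fun x _ => ?_).congr_deriv ?_
    · exact mul_ne_zero (hf_ne x hx) (hf_ne x hx)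
    · simp only [div_eq_mul_inv, sq]
    · filter_upwards [ae_restrict_mem measurableSet_Ioo] with x hx
      have hfx := hf_ne x (Ioo_subset_Icc_self hx)
      field
  exact hprim.hasW12Deriv ((memLp_of_continuousOn_Icc
    (continuousOn_const.mul h.fst.continuousOn).neg 2).add (memLp_mul_continuousOn hf'
      ((continuousOn_const.mul h.snd.continuousOn).div (hf.continuousOn.pow 3) (hne 3))))

theorem IsImpedanceSystem.isImpedanceExp (hf : IsPrimitiveOn 0 ℓ f f')
    (hf' : MemLp f' 2 (volume.restrict (Ioo 0 ℓ))) (hf_ne : ∀ x ∈ Icc 0 ℓ, f x ≠ 0)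
    (hf_zero : f 0 = 1) {v W : ℝ → ℂ} (h : IsImpedanceSystem ℓ f ρ v W) :
    IsImpedanceExp ℓ f ρ v := by
  have hne : ∀ x ∈ Icc 0 ℓ, f x ^ 2 ≠ 0 := fun x hx => pow_ne_zero 2 (hf_ne x hx)
  have hv := h.fst.continuousOn
  have hf2 : ContinuousOn (fun x => f x ^ 2) (Icc 0 ℓ) := hf.continuousOn.pow 2
  have hv' : ContinuousOn (fun x => W x / f x ^ 2) (Icc 0 ℓ) := h.snd.continuousOn.div hf2 hne
  refine ⟨_, _, hv, hv', h.fst.hasW12Deriv (memLp_of_continuousOn_Icc hv' 2),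
    h.hasW12Deriv_div hf hf' hf_ne, ?_, h.fst_zero,
    by rw [hf_zero, h.snd_zero, one_pow, div_one]⟩
  exact (h.snd.congr fun x hx => (mul_div_cancel₀ _ (hne x hx)).symm).hasW12Deriv
    (memLp_of_continuousOn_Icc (hf2.mul (continuousOn_const.mul hv)).neg 2)

theorem IsSchrodingerSystem.isImpedanceSystem (hf : IsPrimitiveOn 0 ℓ f f')
    (hf_ne : ∀ x ∈ Icc 0 ℓ, f x ≠ 0) (hf_zero : f 0 = 1) {y w : ℝ → ℂ}
    (h : IsSchrodingerSystem ℓ (fun x => f' x / f x) ρ y w) :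
    IsImpedanceSystem ℓ f ρ (fun x => y x / f x) fun x => f x * w x := by
  refine ⟨?_, (hf.mul h.snd).congr_deriv ?_, by rw [h.fst_zero, hf_zero, div_one],
    by rw [hf_zero, h.snd_zero, one_mul]⟩
  · simp only [div_eq_mul_inv (y _)]
    refine (h.fst.mul (hf.inv hf_ne)).congr_deriv ?_
    filter_upwards [ae_restrict_mem measurableSet_Ioo] with x hx
    have hfx := hf_ne x (Ioo_subset_Icc_self hx)
    field
  · filter_upwards [ae_restrict_mem measurableSet_Ioo] with x hx
    have hfx := hf_ne x (Ioo_subset_Icc_self hx)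
    field

section Pairing

variable {y y' w φ : ℝ → ℂ} (hσ : MemLp (fun x => f' x / f x) 2 (volume.restrict (Ioo 0 ℓ)))

include hσ

theorem integrableOn_schrodingerPairing (hy : ContinuousOn y (Icc 0 ℓ))
    (hy' : MemLp y' 2 (volume.restrict (Ioo 0 ℓ))) (hφ : IsTest 0 ℓ φ) :
    IntegrableOn (fun x => (f' x / f x) ^ 2 * (y x * φ x) -
      f' x / f x * (y' x * φ x + y x * deriv φ x)) (Ioo 0 ℓ) := by
  have hsq : IntegrableOn (fun x => f' x / f x * (f' x / f x * (y x * φ x))) (Ioo 0 ℓ) :=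
    hσ.integrable_mul (memLp_mul_continuousOn hσ (hy.mul (hφ.continuousOn _)))
  have hdiff : IntegrableOn (fun x => f' x / f x * (y' x * φ x + y x * deriv φ x)) (Ioo 0 ℓ) :=
    hσ.integrable_mul ((memLp_mul_continuousOn hy' (hφ.continuousOn _)).add
      (memLp_of_continuousOn_Icc (hy.mul (hφ.continuousOn_deriv _)) 2))
  refine (hsq.sub hdiff).congr (.of_forall fun x => ?_)
  simp only [Pi.sub_apply]
  ring

theorem memLp_neg_mul_sub (hy : ContinuousOn y (Icc 0 ℓ)) (hw : ContinuousOn w (Icc 0 ℓ)) :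
    MemLp (fun x => -(f' x / f x * w x) - ρ ^ 2 * y x) 2 (volume.restrict (Ioo 0 ℓ)) :=
  (memLp_mul_continuousOn hσ hw).neg.sub
    (memLp_of_continuousOn_Icc (continuousOn_const.mul hy) 2)

theorem schrodingerPairing_sub_eq (hy : ContinuousOn y (Icc 0 ℓ))
    (hy' : MemLp y' 2 (volume.restrict (Ioo 0 ℓ))) (hw : ContinuousOn w (Icc 0 ℓ))
    (hyw : w =ᵐ[volume.restrict (Ioo 0 ℓ)] fun x => y' x - f' x / f x * y x)
    (hφ : IsTest 0 ℓ φ) :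
    schrodingerPairing ℓ f f' y y' φ - ∫ x in Ioo 0 ℓ, ρ ^ 2 * y x * φ x =
      (∫ x in Ioo 0 ℓ, w x * deriv φ x) +
        ∫ x in Ioo 0 ℓ, (-(f' x / f x * w x) - ρ ^ 2 * y x) * φ x := by
  have hy'φ : IntegrableOn (fun x => y' x * deriv φ x) (Ioo 0 ℓ) :=
    (memLp_mul_continuousOn hy' (hφ.continuousOn_deriv _)).integrable one_le_two
  have hyφ : IntegrableOn (fun x => ρ ^ 2 * y x * φ x) (Ioo 0 ℓ) :=
    (memLp_of_continuousOn_Icc ((continuousOn_const.mul hy).mul (hφ.continuousOn _))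
      2).integrable one_le_two
  have hwφ : IntegrableOn (fun x => w x * deriv φ x) (Ioo 0 ℓ) :=
    (memLp_of_continuousOn_Icc (hw.mul (hφ.continuousOn_deriv _)) 2).integrable one_le_two
  have hw'φ : IntegrableOn (fun x => (-(f' x / f x * w x) - ρ ^ 2 * y x) * φ x) (Ioo 0 ℓ) :=
    (memLp_mul_continuousOn (memLp_neg_mul_sub hσ hy hw)
      (hφ.continuousOn _)).integrable one_le_two
  have hpot := integrableOn_schrodingerPairing hσ hy hy' hφ
  rw [schrodingerPairing, potentialPairing, ← integral_add hy'φ hpot,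
    ← integral_sub (hy'φ.fun_add hpot) hyφ, ← integral_add hwφ hw'φ]
  refine integral_congr_ae ?_
  filter_upwards [hyw] with x hx
  simp only [hx]
  ring

theorem isSchrodingerExp_iff (hℓ : 0 < ℓ) : IsSchrodingerExp ℓ f f' ρ y ↔
    ∃ w, IsSchrodingerSystem ℓ (fun x => f' x / f x) ρ y w := by
  constructor
  · rintro ⟨y', w, hy, hyy', heq, ⟨hw, hwy⟩, hy0, hw0⟩
    refine ⟨w, (hyy'.isPrimitiveOn hℓ hy).congr_deriv ?_, isPrimitiveOn_of_weak hℓ hw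
      (intervalIntegrable_of_memLp_two hℓ.le (memLp_neg_mul_sub hσ hy hw)) fun φ hφ => ?_,
      hy0, hw0⟩
    · filter_upwards [hwy] with x hx
      rw [hx, add_sub_cancel]
    · rw [eq_neg_iff_add_eq_zero, ← schrodingerPairing_sub_eq hσ hy hyy'.memLp_deriv hw hwy hφ,
        heq φ hφ, sub_self]
  · rintro ⟨w, h⟩
    have hy := h.fst.continuousOn
    have hw := h.snd.continuousOn
    have hy' : MemLp (fun x => f' x / f x * y x + w x) 2 (volume.restrict (Ioo 0 ℓ)) :=
      (memLp_mul_continuousOn hσ hy).add (memLp_of_continuousOn_Icc hw 2)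
    have hwy : w =ᵐ[volume.restrict (Ioo 0 ℓ)]
        fun x => f' x / f x * y x + w x - f' x / f x * y x :=
      .of_forall fun x => by ring
    refine ⟨_, w, hy, h.fst.hasW12Deriv hy', fun φ hφ => ?_, ⟨hw, hwy⟩, h.fst_zero, h.snd_zero⟩
    rw [← sub_eq_zero, schrodingerPairing_sub_eq hσ hy hy' hw hwy hφ, h.snd.weak hφ,
      neg_add_cancel]

end Pairing

theorem IsSchrodingerExp.eq_mul (hℓ : 0 < ℓ) (hf : IsPrimitiveOn 0 ℓ f f')
    (hf' : MemLp f' 2 (volume.restrict (Ioo 0 ℓ))) (hf_ne : ∀ x ∈ Icc 0 ℓ, f x ≠ 0)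
    (hf_zero : f 0 = 1) {y v : ℝ → ℂ} (hy : IsSchrodingerExp ℓ f f' ρ y)
    (hv : IsImpedanceExp ℓ f ρ v) {x : ℝ} (hx : x ∈ Icc 0 ℓ) : y x = f x * v x := by
  obtain ⟨w, hw⟩ := (isSchrodingerExp_iff (memLp_logDeriv hf' hf.continuousOn hf_ne) hℓ).1 hy
  obtain ⟨W, hW⟩ := hv.exists_isImpedanceSystem hℓ hf.continuousOn hf_ne hf_zero
  rw [← (hw.isImpedanceSystem hf hf_ne hf_zero).eqOn hf.continuousOn hf_ne hW hx,
    mul_div_cancel₀ _ (hf_ne x hx)]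

end Systems

/-! ### Uniqueness for Fourier integrals -/

section Fourier

open scoped FourierTransform

/-- A test function is `𝓕 (𝓕⁻ Ψ)`, and the Fourier transform is self-adjoint. -/
theorem ae_eq_zero_of_fourier_ae_eq_zero {V F : Type*} [NormedAddCommGroup V]
    [InnerProductSpace ℝ V] [FiniteDimensional ℝ V] [MeasurableSpace V] [BorelSpace V]
    [NormedAddCommGroup F] [NormedSpace ℂ F] [CompleteSpace F] {g : V → F} (hg : Integrable g)
    (h : 𝓕 g =ᵐ[volume] 0) : g =ᵐ[volume] 0 := by
  refine ae_eq_zero_of_integral_contDiff_smul_eq_zero hg.locallyIntegrable fun ψ hψ hψc => ?_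
  have hΨc : HasCompactSupport fun x => (ψ x : ℂ) := hψc.comp_left Complex.ofReal_zero
  set Ψ := hΨc.toSchwartzMap (Complex.ofRealCLM.contDiff.comp hψ)
  have hadj : ∫ x, 𝓕 (𝓕⁻ Ψ) x • g x = ∫ x, (𝓕⁻ Ψ) x • 𝓕 g x := by
    have hflip := VectorFourier.integral_fourierIntegral_smul_eq_flip (L := innerₗ V)
      Real.continuous_fourierChar continuous_inner ((𝓕⁻ Ψ).integrable (μ := volume)) hg
    rwa [flip_innerₗ] at hflip
  rw [FourierTransform.fourier_fourierInv_eq] at hadj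
  calc ∫ x, ψ x • g x = ∫ x, Ψ x • g x :=
      integral_congr_ae (.of_forall fun x => (Complex.coe_smul (ψ x) (g x)).symm)
    _ = 0 := hadj.trans (integral_eq_zero_of_ae (h.mono fun x hx => by simp [hx]))

theorem ae_eq_zero_of_integral_mul_exp_eq_zero {a b : ℝ} (hab : a ≤ b) {g : ℝ → ℂ}
    (hg : IntervalIntegrable g volume a b)
    (h : ∀ ρ : ℝ, ρ ≠ 0 → ∫ t in a..b, g t * Complex.exp (Complex.I * ρ * t) = 0) :
    g =ᵐ[volume.restrict (Ioo a b)] 0 := by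
  have hgab : Integrable ((Ioo a b).indicator g) :=
    ((intervalIntegrable_iff_integrableOn_Ioo_of_le hab).1 hg).integrable_indicator
      measurableSet_Ioo
  refine (indicator_ae_eq_restrict measurableSet_Ioo).symm.trans
    (ae_restrict_of_ae (ae_eq_zero_of_fourier_ae_eq_zero hgab ?_))
  filter_upwards [Measure.ae_ne volume (0 : ℝ)] with ξ hξ
  rw [Pi.zero_apply, Real.fourier_real_eq_integral_exp_smul,
    ← h (-2 * Real.pi * ξ) (by simp [hξ, Real.pi_ne_zero]), ← integral_Ioo_eq_intervalIntegral hab,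
    ← integral_indicator measurableSet_Ioo]
  refine integral_congr_ae (.of_forall fun t => ?_)
  by_cases ht : t ∈ Ioo a b
  · simp only [indicator_of_mem ht, smul_eq_mul]
    rw [mul_comm]
    push_cast
    ring_nf
  · simp only [indicator_of_notMem ht, smul_zero]

theorem continuous_cexp_mul (ρ : ℂ) : Continuous fun t : ℝ => Complex.exp (Complex.I * ρ * t) := by
  fun_prop

theorem ae_eq_of_integral_mul_exp_eq {a b : ℝ} (hab : a ≤ b) {g h : ℝ → ℂ}
    (hg : IntervalIntegrable g volume a b) (hh : IntervalIntegrable h volume a b)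
    (heq : ∀ ρ : ℝ, ρ ≠ 0 → ∫ t in a..b, g t * Complex.exp (Complex.I * ρ * t) =
      ∫ t in a..b, h t * Complex.exp (Complex.I * ρ * t)) :
    g =ᵐ[volume.restrict (Ioo a b)] h := by
  refine (ae_eq_zero_of_integral_mul_exp_eq_zero hab (hg.sub hh) fun ρ hρ => ?_).mono
    fun t ht => sub_eq_zero.1 ht
  simp only [sub_mul]
  rw [intervalIntegral.integral_sub (hg.mul_continuousOn (continuous_cexp_mul ρ).continuousOn)
    (hh.mul_continuousOn (continuous_cexp_mul ρ).continuousOn), heq ρ hρ, sub_self]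

theorem isPrimitiveOn_cexp_mul {a b : ℝ} (hab : a ≤ b) (ρ : ℂ) :
    IsPrimitiveOn a b (fun t => Complex.exp (Complex.I * ρ * t))
      fun t => Complex.I * ρ * Complex.exp (Complex.I * ρ * t) := by
  refine .of_hasDerivAt hab (fun x => ?_) (by fun_prop)
  have hlin : HasDerivAt (fun t : ℝ => Complex.I * ρ * (t : ℂ)) (Complex.I * ρ) x := by
    simpa using (Complex.ofRealCLM.hasDerivAt (x := x)).const_mul (Complex.I * ρ)
  simpa only [mul_comm] using hlin.cexp

end Fourier

theorem HasW12Deriv.ae_unique {a b : ℝ} (hab : a < b) {u v w : ℝ → ℂ}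
    (hv : HasW12Deriv a b u v) (hw : HasW12Deriv a b u w) :
    v =ᵐ[volume.restrict (Ioo a b)] w := by
  have hsub := hv.memLp_deriv.sub hw.memLp_deriv
  have hzero : IsPrimitiveOn a b (fun _ => 0) (v - w) := by
    refine isPrimitiveOn_of_weak hab continuousOn_const
      (intervalIntegrable_of_memLp_two hab.le hsub) fun φ hφ => ?_
    have hint : ∀ {z}, MemLp z 2 (volume.restrict (Ioo a b)) →
        IntegrableOn (fun x => z x * φ x) (Ioo a b) := fun hz =>
      (memLp_mul_continuousOn hz (hφ.continuousOn _)).integrable one_le_two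
    simp only [Pi.sub_apply, sub_mul, zero_mul, integral_zero]
    rw [integral_sub (hint hv.memLp_deriv) (hint hw.memLp_deriv),
      neg_inj.1 ((hv.weak φ hφ).symm.trans (hw.weak φ hφ)), sub_self, neg_zero]
  filter_upwards [hzero.ae_hasDerivAt] with x hx
  exact sub_eq_zero.1 (hx.unique (hasDerivAt_const x 0))

/-! ### The two kernels on a slice -/

section Slice

theorem integral_mul_congr_of_ae_eq {a b : ℝ} (hab : a ≤ b) {g h u v : ℝ → ℂ}
    (hgh : g =ᵐ[volume.restrict (Ioo a b)] h) (huv : u =ᵐ[volume.restrict (Ioo a b)] v) :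
    ∫ t in a..b, g t * u t = ∫ t in a..b, h t * v t := by
  rw [← integral_Ioo_eq_intervalIntegral hab, ← integral_Ioo_eq_intervalIntegral hab]
  exact integral_congr_ae (hgh.mul huv)

/-- The kernel of the impedance operator expressed through the kernel `K` of the Schrödinger
operator: on each slice, the primitive of `K(x,·)/f(x)` that vanishes at `-x`. -/
noncomputable def primitiveKernel (f : ℝ → ℂ) (K : ℝ → ℝ → ℂ) (x t : ℝ) : ℂ :=
  1 / f x * ∫ s in (-x)..t, K x s

theorem primitiveKernel_neg (f : ℝ → ℂ) (K : ℝ → ℝ → ℂ) (x : ℝ) :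
    primitiveKernel f K x (-x) = 0 := by
  rw [primitiveKernel, intervalIntegral.integral_same, mul_zero]

variable {ℓ x : ℝ} {f f' : ℝ → ℂ} {K Kh : ℝ → ℝ → ℂ}

theorem isPrimitiveOn_primitiveKernel (f : ℝ → ℂ) (hx : 0 ≤ x)
    (hK : IntervalIntegrable (K x) volume (-x) x) :
    IsPrimitiveOn (-x) x (primitiveKernel f K x) fun t => 1 / f x * K x t := by
  have hprim := (IsPrimitiveOn.const_add_integral (neg_le_self hx) 0 hK).const_mul (1 / f x)
  simp only [zero_add] at hprim
  exact hprim

theorem isSchrodingerSystem_zero (hf : IsPrimitiveOn 0 ℓ f f') (hf_ne : ∀ x ∈ Icc 0 ℓ, f x ≠ 0)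
    (hf_zero : f 0 = 1) : IsSchrodingerSystem ℓ (fun x => f' x / f x) 0 f fun _ => 0 := by
  refine ⟨hf.congr_deriv ?_, ⟨hf.le, by simp, by simp⟩, hf_zero, (mul_zero _).symm⟩
  filter_upwards [ae_restrict_mem measurableSet_Ioo] with x hx
  rw [div_mul_cancel₀ _ (hf_ne x (Ioo_subset_Icc_self hx)), add_zero]

variable (hℓ : 0 < ℓ) (hf : IsPrimitiveOn 0 ℓ f f')
  (hf' : MemLp f' 2 (volume.restrict (Ioo 0 ℓ))) (hf_ne : ∀ x ∈ Icc 0 ℓ, f x ≠ 0)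
  (hf_zero : f 0 = 1)

include hℓ hf hf' hf_ne hf_zero

theorem IsSchrodingerExp.isImpedanceExp_div {ρ : ℂ} {y : ℝ → ℂ} (hy : IsSchrodingerExp ℓ f f' ρ y) :
    IsImpedanceExp ℓ f ρ fun x => y x / f x := by
  obtain ⟨w, hw⟩ := (isSchrodingerExp_iff (memLp_logDeriv hf' hf.continuousOn hf_ne) hℓ).1 hy
  exact (hw.isImpedanceSystem hf hf_ne hf_zero).isImpedanceExp hf hf' hf_ne hf_zero

theorem IsSchrodingerExp.eqOn {ρ : ℂ} {y₁ y₂ : ℝ → ℂ} (h₁ : IsSchrodingerExp ℓ f f' ρ y₁)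
    (h₂ : IsSchrodingerExp ℓ f f' ρ y₂) : EqOn y₁ y₂ (Icc 0 ℓ) := fun x hx => by
  rw [h₁.eq_mul hℓ hf hf' hf_ne hf_zero (h₂.isImpedanceExp_div hℓ hf hf' hf_ne hf_zero) hx,
    mul_div_cancel₀ _ (hf_ne x hx)]

namespace IsSchrodingerKernel

theorem ae_unique {K₁ K₂ : ℝ → ℝ → ℂ} (h₁ : IsSchrodingerKernel ℓ f f' K₁)
    (h₂ : IsSchrodingerKernel ℓ f f' K₂) (hx : x ∈ Ioc 0 ℓ) :
    K₁ x =ᵐ[volume.restrict (Ioo (-x) x)] K₂ x := by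
  refine ae_eq_of_integral_mul_exp_eq (neg_le_self hx.1.le) (h₁.1.2 x hx) (h₂.1.2 x hx)
    fun ρ _ => ?_
  obtain ⟨e₁, he₁, heq₁⟩ := h₁.2 ρ
  obtain ⟨e₂, he₂, heq₂⟩ := h₂.2 ρ
  have heq := he₁.eqOn hℓ hf hf' hf_ne hf_zero he₂ (Ioc_subset_Icc_self hx)
  rw [heq₁ x hx, heq₂ x hx] at heq
  exact add_left_cancel heq

/-- For `ρ = 0` the Schrödinger exponential is `f` itself. -/
theorem integral_eq (hK : IsSchrodingerKernel ℓ f f' K) (hx : x ∈ Ioc 0 ℓ) :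
    ∫ t in (-x)..x, K x t = f x - 1 := by
  obtain ⟨e, he, heq⟩ := hK.2 0
  have hexp : IsSchrodingerExp ℓ f f' 0 f :=
    (isSchrodingerExp_iff (memLp_logDeriv hf' hf.continuousOn hf_ne) hℓ).2
      ⟨_, isSchrodingerSystem_zero hf hf_ne hf_zero⟩
  rw [hexp.eqOn hℓ hf hf' hf_ne hf_zero he (Ioc_subset_Icc_self hx), heq x hx]
  simp

theorem primitiveKernel_self (hK : IsSchrodingerKernel ℓ f f' K) (hx : x ∈ Ioc 0 ℓ) :
    primitiveKernel f K x x = 1 - 1 / f x := by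
  rw [primitiveKernel, hK.integral_eq hℓ hf hf' hf_ne hf_zero hx, mul_sub, mul_one,
    one_div_mul_cancel (hf_ne x (Ioc_subset_Icc_self hx))]

theorem impedanceOp_primitiveKernel (hK : IsSchrodingerKernel ℓ f f' K) (hx : x ∈ Ioc 0 ℓ)
    {v v' : ℝ → ℂ} (hv : IsPrimitiveOn (-x) x v v') :
    impedanceOp (primitiveKernel f K) v v' x = 1 / f x * schrodingerOp K v x := by
  rw [impedanceOp, schrodingerOp,
    (isPrimitiveOn_primitiveKernel f hx.1.le (hK.1.2 x hx)).integral_mul_eq hv,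
    hK.primitiveKernel_self hℓ hf hf' hf_ne hf_zero hx, primitiveKernel_neg]
  simp only [mul_assoc]
  rw [intervalIntegral.integral_const_mul]
  ring

theorem exp_sub_integral_primitiveKernel (hK : IsSchrodingerKernel ℓ f f' K) (hx : x ∈ Ioc 0 ℓ)
    {ρ : ℂ} {e : ℝ → ℂ} (he : e x = Complex.exp (Complex.I * ρ * x) +
      ∫ t in (-x)..x, K x t * Complex.exp (Complex.I * ρ * t)) :
    e x / f x = Complex.exp (Complex.I * ρ * x) -
      Complex.I * ρ *
        ∫ t in (-x)..x, primitiveKernel f K x t * Complex.exp (Complex.I * ρ * t) := by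
  have hop := hK.impedanceOp_primitiveKernel hℓ hf hf' hf_ne hf_zero hx
    (isPrimitiveOn_cexp_mul (neg_le_self hx.1.le) ρ)
  rw [schrodingerOp, ← he, impedanceOp] at hop
  rw [div_eq_mul_one_div, mul_comm, ← hop, ← intervalIntegral.integral_const_mul]
  simp only [mul_left_comm]

theorem isImpedanceKernel_primitiveKernel (hK : IsSchrodingerKernel ℓ f f' K)
    (hK' : IsTriangleKernel ℓ (primitiveKernel f K)) :
    IsImpedanceKernel ℓ f (primitiveKernel f K) := by
  refine ⟨hK', fun ρ => ?_⟩
  obtain ⟨e, he, heq⟩ := hK.2 ρ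
  exact ⟨_, he.isImpedanceExp_div hℓ hf hf' hf_ne hf_zero, fun x hx =>
    hK.exp_sub_integral_primitiveKernel hℓ hf hf' hf_ne hf_zero hx (heq x hx)⟩

theorem ae_eq_primitiveKernel (hK : IsSchrodingerKernel ℓ f f' K) (hKh : IsImpedanceKernel ℓ f Kh)
    (hx : x ∈ Ioc 0 ℓ) : Kh x =ᵐ[volume.restrict (Ioo (-x) x)] primitiveKernel f K x := by
  have hprim := isPrimitiveOn_primitiveKernel f hx.1.le (hK.1.2 x hx)
  refine ae_eq_of_integral_mul_exp_eq hprim.le (hKh.1.2 x hx)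
    hprim.continuousOn_uIcc.intervalIntegrable fun ρ hρ => ?_
  obtain ⟨e, he, heq⟩ := hK.2 ρ
  obtain ⟨v, hv, hveq⟩ := hKh.2 ρ
  have hquot := hK.exp_sub_integral_primitiveKernel hℓ hf hf' hf_ne hf_zero hx (heq x hx)
  have hxℓ := Ioc_subset_Icc_self hx
  rw [he.eq_mul hℓ hf hf' hf_ne hf_zero hv hxℓ, mul_div_cancel_left₀ _ (hf_ne x hxℓ),
    hveq x hx] at hquot
  exact mul_left_cancel₀ (mul_ne_zero Complex.I_ne_zero (Complex.ofReal_ne_zero.2 hρ))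
    (sub_right_inj.1 hquot)

theorem impedanceOp_eq (hK : IsSchrodingerKernel ℓ f f' K) (hKh : IsImpedanceKernel ℓ f Kh)
    (hx : x ∈ Ioc 0 ℓ) {u v v' : ℝ → ℂ} (hv : IsPrimitiveOn (-ℓ) ℓ v v')
    (huv : u =ᵐ[volume.restrict (Ioo (-ℓ) ℓ)] v) (hux : u x = v x) :
    impedanceOp Kh u v' x = 1 / f x * schrodingerOp K u x := by
  have hxx : -x ≤ x := neg_le_self hx.1.le
  have hxℓ : -ℓ ≤ -x := neg_le_neg hx.2
  have hop := hK.impedanceOp_primitiveKernel hℓ hf hf' hf_ne hf_zero hx (hv.mono hxℓ hxx hx.2)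
  have hKh_eq := hK.ae_eq_primitiveKernel hℓ hf hf' hf_ne hf_zero hKh hx
  have huv_x := ae_restrict_of_ae_restrict_of_subset (Ioo_subset_Ioo hxℓ hx.2) huv
  rw [impedanceOp, schrodingerOp] at hop ⊢
  rw [hux, integral_mul_congr_of_ae_eq hxx hKh_eq .rfl,
    integral_mul_congr_of_ae_eq hxx (.rfl (f := K x)) huv_x, hop]

theorem isContinuousRep_primitiveKernel (hK : IsSchrodingerKernel ℓ f f' K)
    (hKh : IsImpedanceKernel ℓ f Kh) (hx : x ∈ Ioc 0 ℓ) :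
    IsContinuousRep (-x) x (Kh x) (primitiveKernel f K x) :=
  ⟨(isPrimitiveOn_primitiveKernel f hx.1.le (hK.1.2 x hx)).continuousOn,
    (hK.ae_eq_primitiveKernel hℓ hf hf' hf_ne hf_zero hKh hx).symm⟩

end IsSchrodingerKernel

end Slice

/-! ### The triangle -/

section Triangle

theorem isClosed_triangle (ℓ : ℝ) : IsClosed (triangle ℓ) :=
  (isClosed_le continuous_const continuous_fst).inter
    ((isClosed_le continuous_fst continuous_const).inter
      (isClosed_le continuous_snd.abs continuous_fst))

theorem isCompact_triangle (ℓ : ℝ) : IsCompact (triangle ℓ) := by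
  refine (isCompact_Icc (a := (0, -ℓ)) (b := ((ℓ, ℓ) : ℝ × ℝ))).of_isClosed_subset
    (isClosed_triangle ℓ) fun p hp => ?_
  have ht := abs_le.1 (hp.2.2.trans hp.2.1)
  exact ⟨⟨hp.1, ht.1⟩, ⟨hp.2.1, ht.2⟩⟩

theorem memLp_triangle_of_norm_le {ℓ C : ℝ} {g : ℝ × ℝ → ℂ}
    (hg : AEStronglyMeasurable g (volume.restrict (triangle ℓ))) (hC : ∀ p ∈ triangle ℓ, ‖g p‖ ≤ C)
    (p : ENNReal) : MemLp g p (volume.restrict (triangle ℓ)) := by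
  have hfin : IsFiniteMeasure (volume.restrict (triangle ℓ)) :=
    ⟨by simpa using (isCompact_triangle ℓ).measure_lt_top⟩
  refine (memLp_top_of_bound hg C ?_).mono_exponent le_top
  filter_upwards [ae_restrict_mem (isClosed_triangle ℓ).measurableSet] using hC

theorem ae_prod_eq_zero_of_ae_ae_eq_zero {α β E : Type*} [MeasurableSpace α] [MeasurableSpace β]
    [NormedAddCommGroup E] {μ : Measure α} {ν : Measure β} [SFinite ν] {g : α × β → E}
    (hg : AEStronglyMeasurable g (μ.prod ν)) (h : ∀ᵐ x ∂μ, ∀ᵐ y ∂ν, g (x, y) = 0) :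
    g =ᵐ[μ.prod ν] 0 := by
  refine hg.ae_eq_mk.trans ((Measure.ae_prod_iff_ae_ae
    (hg.stronglyMeasurable_mk.measurableSet_eq_fun stronglyMeasurable_zero)).2 ?_)
  filter_upwards [h, Measure.ae_ae_of_ae_prod hg.ae_eq_mk] with x hx hmk
  filter_upwards [hx, hmk] with y hy hmky
  rw [← hmky, hy, Pi.zero_apply]

theorem ae_triangle_eq_zero_of_slices {ℓ : ℝ} {g : ℝ × ℝ → ℂ}
    (hg : AEStronglyMeasurable g (volume.restrict (triangle ℓ)))
    (h : ∀ x ∈ Ioc 0 ℓ, ∀ᵐ t ∂volume.restrict (Ioo (-x) x), g (x, t) = 0) :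
    ∀ᵐ p ∂volume.restrict (triangle ℓ), g p = 0 := by
  have hT := (isClosed_triangle ℓ).measurableSet
  have hslice : ∀ᵐ x : ℝ, ∀ᵐ t : ℝ, (triangle ℓ).indicator g (x, t) = 0 := by
    filter_upwards [Measure.ae_ne volume (0 : ℝ)] with x hx0
    by_cases hx : x ∈ Ioc 0 ℓ
    · filter_upwards [(ae_restrict_iff' measurableSet_Ioo).1 (h x hx),
        ae_mem_Ioo_of_mem_uIcc (neg_le_self hx.1.le)] with t ht htx
      refine indicator_apply_eq_zero.2 fun hp => ht (htx ?_)
      rw [uIcc_of_le (neg_le_self hx.1.le)]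
      exact abs_le.1 hp.2.2
    · exact .of_forall fun t =>
        indicator_of_notMem (fun hp => hx ⟨lt_of_le_of_ne hp.1 hx0.symm, hp.2.1⟩) _
  have hzero := ae_prod_eq_zero_of_ae_ae_eq_zero ((aestronglyMeasurable_indicator_iff hT).2 hg)
    hslice
  exact (indicator_ae_eq_restrict hT).symm.trans (ae_restrict_of_ae hzero)

theorem ae_triangle_eq_of_slices {ℓ : ℝ} {g h : ℝ → ℝ → ℂ}
    (hg : AEStronglyMeasurable (Function.uncurry g) (volume.restrict (triangle ℓ)))
    (hh : AEStronglyMeasurable (Function.uncurry h) (volume.restrict (triangle ℓ)))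
    (heq : ∀ x ∈ Ioc 0 ℓ, g x =ᵐ[volume.restrict (Ioo (-x) x)] h x) :
    ∀ᵐ p ∂volume.restrict (triangle ℓ), g p.1 p.2 = h p.1 p.2 := by
  have hzero := ae_triangle_eq_zero_of_slices (hg.sub hh) fun x hx =>
    (heq x hx).mono fun t ht => sub_eq_zero.2 ht
  exact hzero.mono fun p hp => sub_eq_zero.1 hp

theorem aestronglyMeasurable_triangle_div_mul {ℓ : ℝ} {f : ℝ → ℂ} {K : ℝ → ℝ → ℂ}
    (hf : ContinuousOn f (Icc 0 ℓ)) (hf_ne : ∀ x ∈ Icc 0 ℓ, f x ≠ 0)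
    (hK : AEStronglyMeasurable (Function.uncurry K) (volume.restrict (triangle ℓ))) :
    AEStronglyMeasurable (Function.uncurry fun x t => 1 / f x * K x t)
      (volume.restrict (triangle ℓ)) := by
  have hinv : ContinuousOn (fun p : ℝ × ℝ => 1 / f p.1) (triangle ℓ) :=
    (continuousOn_const.div hf hf_ne).comp continuous_fst.continuousOn fun p hp => ⟨hp.1, hp.2.1⟩
  exact (hinv.aestronglyMeasurable (isClosed_triangle ℓ).measurableSet).mul hK

end Triangle

/-! ### Volterra operators on kernels supported in a cone -/

/-- A measurable kernel that vanishes outside the cone `|t| ≤ x`. -/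
structure IsConeKernel (g : ℝ → ℝ → ℂ) : Prop where
  measurable : StronglyMeasurable (Function.uncurry g)
  support : ∀ x t, x < |t| → g x t = 0

/-- The Volterra operator `g ↦ ∫₀ˣ σ(s) g(s, t + ε (x - s)) ds`, which integrates along the
characteristic of slope `-ε` through `(x, t)`; it is used for `ε = ± 1`. -/
noncomputable def volterra (σ : ℝ → ℂ) (ε : ℝ) (g : ℝ → ℝ → ℂ) (x t : ℝ) : ℂ :=
  ∫ s in Ioc 0 x, σ s * g s (t + ε * (x - s))

theorem abs_le_abs_add_mul_sub {ε : ℝ} (hε : |ε| = 1) {s x : ℝ} (hsx : s ≤ x) (t : ℝ) :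
    |t| ≤ |t + ε * (x - s)| + (x - s) := by
  have habs : |ε * (x - s)| = x - s := by
    rw [abs_mul, hε, one_mul, abs_of_nonneg (sub_nonneg.2 hsx)]
  simpa [habs] using abs_sub (t + ε * (x - s)) (ε * (x - s))

theorem stronglyMeasurable_setIntegral_Ioc {α : Type*} [MeasurableSpace α]
    {F : α → ℝ → ℂ} {a b : α → ℝ}
    (hF : StronglyMeasurable (Function.uncurry F)) (ha : Measurable a) (hb : Measurable b) :
    StronglyMeasurable fun p => ∫ s in Ioc (a p) (b p), F p s := by
  have heq : (fun p => ∫ s in Ioc (a p) (b p), F p s)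
      = fun p => ∫ s, (Ioc (a p) (b p)).indicator (F p) s :=
    funext fun p => (integral_indicator measurableSet_Ioc).symm
  rw [heq]
  have hleft : MeasurableSet {q : α × ℝ | a q.1 < q.2} :=
    measurableSet_lt (ha.comp measurable_fst) measurable_snd
  have hright : MeasurableSet {q : α × ℝ | q.2 ≤ b q.1} :=
    measurableSet_le measurable_snd (hb.comp measurable_fst)
  exact StronglyMeasurable.integral_prod_right
    (f := fun p s => (Ioc (a p) (b p)).indicator (F p) s) (hF.indicator (hleft.inter hright))

namespace IsConeKernel

variable {σ : ℝ → ℂ} {g h : ℝ → ℝ → ℂ}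

theorem slice (hg : IsConeKernel g) (x : ℝ) : StronglyMeasurable (g x) :=
  hg.measurable.comp_measurable measurable_prodMk_left

theorem eq_zero_of_notMem_Icc (hg : IsConeKernel g) {x t : ℝ} (ht : t ∉ Icc (-x) x) :
    g x t = 0 :=
  hg.support x t (not_le.1 fun h => ht (abs_le.1 h))

protected theorem add (hg : IsConeKernel g) (hh : IsConeKernel h) :
    IsConeKernel fun x t => g x t + h x t :=
  ⟨hg.measurable.add hh.measurable, fun x t hxt => by
    rw [hg.support x t hxt, hh.support x t hxt, add_zero]⟩

theorem comp_shear_eq_zero (hg : IsConeKernel g) {ε : ℝ} (hε : |ε| = 1) {s x t : ℝ} (hsx : s ≤ x)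
    (hxt : x < |t|) : g s (t + ε * (x - s)) = 0 :=
  hg.support _ _ (by linarith [abs_le_abs_add_mul_sub hε hsx t])

theorem stronglyMeasurable_mul_comp_shear (hg : IsConeKernel g) (hσm : StronglyMeasurable σ)
    (ε x t : ℝ) : StronglyMeasurable fun s => σ s * g s (t + ε * (x - s)) :=
  hσm.mul (hg.measurable.comp_measurable (g := fun s => (s, t + ε * (x - s))) (by fun_prop))

protected theorem volterra (hg : IsConeKernel g) (hσm : StronglyMeasurable σ) {ε : ℝ}
    (hε : |ε| = 1) :
    IsConeKernel (volterra σ ε g) := by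
  refine ⟨?_, fun x t hxt => setIntegral_eq_zero_of_forall_eq_zero fun s hs => ?_⟩
  · have hσ₂ : StronglyMeasurable fun q : (ℝ × ℝ) × ℝ => σ q.2 :=
      hσm.comp_measurable measurable_snd
    have hg₂ : StronglyMeasurable fun q : (ℝ × ℝ) × ℝ => g q.2 (q.1.2 + ε * (q.1.1 - q.2)) :=
      hg.measurable.comp_measurable
        (g := fun q : (ℝ × ℝ) × ℝ => (q.2, q.1.2 + ε * (q.1.1 - q.2))) (by fun_prop)
    exact stronglyMeasurable_setIntegral_Ioc
      (F := fun (p : ℝ × ℝ) s => σ s * g s (p.2 + ε * (p.1 - s))) (hσ₂.mul hg₂) measurable_const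
      measurable_fst
  · rw [hg.comp_shear_eq_zero hε hs.2 hxt, mul_zero]

end IsConeKernel

theorem volterra_add {σ : ℝ → ℂ} {ε : ℝ} {g h : ℝ → ℝ → ℂ} {x t : ℝ}
    (hg : IntegrableOn (fun s => σ s * g s (t + ε * (x - s))) (Ioc 0 x))
    (hh : IntegrableOn (fun s => σ s * h s (t + ε * (x - s))) (Ioc 0 x)) :
    volterra σ ε (fun x t => g x t + h x t) x t = volterra σ ε g x t + volterra σ ε h x t := by
  rw [volterra, volterra, volterra, ← integral_add hg hh]
  simp only [mul_add]

/-! ### Bounded kernels -/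

/-- The weight `exp (2 ∫₀ˣ ‖σ‖)`, in which both Volterra operators have norm at most `1 / 2`. -/
noncomputable def volterraWeight (σ : ℝ → ℂ) (x : ℝ) : ℝ :=
  Real.exp (2 * ∫ s in Ioc 0 x, ‖σ s‖)

section Weight

variable {σ : ℝ → ℂ}

theorem one_le_volterraWeight (σ : ℝ → ℂ) (x : ℝ) : 1 ≤ volterraWeight σ x :=
  Real.one_le_exp (mul_nonneg zero_le_two (integral_nonneg fun _ => norm_nonneg _))

theorem volterraWeight_pos (σ : ℝ → ℂ) (x : ℝ) : 0 < volterraWeight σ x := Real.exp_pos _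

theorem volterraWeight_zero (σ : ℝ → ℂ) : volterraWeight σ 0 = 1 := by simp [volterraWeight]

theorem monotone_volterraWeight (hσ : Integrable σ) : Monotone (volterraWeight σ) :=
  fun _ _ hxy => Real.exp_le_exp.2 (mul_le_mul_of_nonneg_left
    (setIntegral_mono_set hσ.norm.integrableOn (.of_forall fun _ => norm_nonneg _)
      (Ioc_subset_Ioc_right hxy).eventuallyLE) zero_le_two)

theorem isPrimitiveOn_volterraWeight (hσ : Integrable σ) {x : ℝ} (hx : 0 ≤ x) :
    IsPrimitiveOn 0 x (volterraWeight σ) fun s => 2 * ‖σ s‖ * volterraWeight σ s := by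
  have hF := (IsPrimitiveOn.const_add_integral hx (0 : ℝ)
    hσ.norm.intervalIntegrable).const_mul 2
  have heq : ∀ y ∈ Icc 0 x, Real.exp (2 * (0 + ∫ s in (0 : ℝ)..y, ‖σ s‖)) = volterraWeight σ y :=
    fun y hy => by rw [zero_add, intervalIntegral.integral_of_le hy.1, volterraWeight]
  refine (hF.exp.congr heq).congr_deriv ?_
  filter_upwards [ae_restrict_mem measurableSet_Ioo] with y hy
  rw [heq y (Ioo_subset_Icc_self hy)]

theorem integrableOn_norm_mul_volterraWeight (hσ : Integrable σ) (x : ℝ) :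
    IntegrableOn (fun s => ‖σ s‖ * volterraWeight σ s) (Ioc 0 x) := by
  rcases le_or_gt x 0 with hx | hx
  · simp [Ioc_eq_empty hx.not_gt]
  · have hW := (isPrimitiveOn_volterraWeight hσ hx.le).integrable.const_mul (1 / 2)
    rw [intervalIntegrable_iff_integrableOn_Ioc_of_le hx.le] at hW
    exact hW.congr (.of_forall fun s => by ring)

theorem integral_norm_mul_volterraWeight_le (hσ : Integrable σ) (x : ℝ) :
    ∫ s in Ioc 0 x, ‖σ s‖ * volterraWeight σ s ≤ volterraWeight σ x / 2 := by
  rcases le_or_gt x 0 with hx | hx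
  · simpa [Ioc_eq_empty hx.not_gt] using (half_pos (volterraWeight_pos σ x)).le
  · have hW := (isPrimitiveOn_volterraWeight hσ hx.le).integral_eq
    simp only [mul_assoc] at hW
    rw [intervalIntegral.integral_const_mul, volterraWeight_zero,
      intervalIntegral.integral_of_le hx.le] at hW
    linarith

end Weight

/-- A cone kernel dominated by `C` times the weight `volterraWeight σ`; on these the Neumann series
of the Volterra operators of `σ` converges. -/
structure IsBoundedKernel (σ : ℝ → ℂ) (C : ℝ) (g : ℝ → ℝ → ℂ) : Prop extends IsConeKernel g where
  bound : ∀ x t, ‖g x t‖ ≤ C * volterraWeight σ x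

namespace IsBoundedKernel

variable {σ : ℝ → ℂ} {C : ℝ} {g : ℝ → ℝ → ℂ}

theorem nonneg (hg : IsBoundedKernel σ C g) : 0 ≤ C :=
  nonneg_of_mul_nonneg_left ((norm_nonneg _).trans (hg.bound 0 0)) (volterraWeight_pos σ 0)

theorem norm_le (hσ : Integrable σ) (hg : IsBoundedKernel σ C g) {x ℓ : ℝ} (hx : x ≤ ℓ) (t : ℝ) :
    ‖g x t‖ ≤ C * volterraWeight σ ℓ :=
  (hg.bound x t).trans
    (mul_le_mul_of_nonneg_left (monotone_volterraWeight hσ hx) hg.nonneg)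

theorem norm_mul_comp_shear_le (hg : IsBoundedKernel σ C g) (ε x t s : ℝ) :
    ‖σ s * g s (t + ε * (x - s))‖ ≤ C * (‖σ s‖ * volterraWeight σ s) := by
  rw [norm_mul, mul_left_comm]
  exact mul_le_mul_of_nonneg_left (hg.bound _ _) (norm_nonneg _)

theorem integrableOn (hσm : StronglyMeasurable σ) (hσ : Integrable σ)
    (hg : IsBoundedKernel σ C g) (ε x t : ℝ) :
    IntegrableOn (fun s => σ s * g s (t + ε * (x - s))) (Ioc 0 x) :=
  ((integrableOn_norm_mul_volterraWeight hσ x).const_mul C).mono'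
    (hg.stronglyMeasurable_mul_comp_shear hσm ε x t).aestronglyMeasurable
    (.of_forall (hg.norm_mul_comp_shear_le ε x t))

theorem integral_norm_le (hσ : Integrable σ) (hg : IsBoundedKernel σ C g) (ε x t : ℝ) :
    ∫ s in Ioc 0 x, ‖σ s * g s (t + ε * (x - s))‖ ≤ C / 2 * volterraWeight σ x :=
  calc ∫ s in Ioc 0 x, ‖σ s * g s (t + ε * (x - s))‖
      ≤ ∫ s in Ioc 0 x, C * (‖σ s‖ * volterraWeight σ s) :=
        integral_mono_of_nonneg (.of_forall fun _ => norm_nonneg _)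
          ((integrableOn_norm_mul_volterraWeight hσ x).const_mul C)
          (.of_forall (hg.norm_mul_comp_shear_le ε x t))
    _ = C * ∫ s in Ioc 0 x, ‖σ s‖ * volterraWeight σ s := integral_const_mul _ _
    _ ≤ C * (volterraWeight σ x / 2) :=
        mul_le_mul_of_nonneg_left (integral_norm_mul_volterraWeight_le hσ x) hg.nonneg
    _ = C / 2 * volterraWeight σ x := by ring

protected theorem volterra (hσm : StronglyMeasurable σ) (hσ : Integrable σ) {ε : ℝ} (hε : |ε| = 1)
    (hg : IsBoundedKernel σ C g) : IsBoundedKernel σ (C / 2) (volterra σ ε g) :=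
  ⟨hg.toIsConeKernel.volterra hσm hε, fun x t =>
    (norm_integral_le_integral_norm _).trans (hg.integral_norm_le hσ ε x t)⟩

section Series

variable {c : ℕ → ℝ} {G : ℕ → ℝ → ℝ → ℂ}

protected theorem summable (hG : ∀ n, IsBoundedKernel σ (c n) (G n)) (hc : Summable c) (x t : ℝ) :
    Summable fun n => G n x t :=
  Summable.of_norm_bounded (hc.mul_right _) fun n => (hG n).bound x t

protected theorem tsum (hG : ∀ n, IsBoundedKernel σ (c n) (G n)) (hc : Summable c) :
    IsBoundedKernel σ (∑' n, c n) fun x t => ∑' n, G n x t := by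
  refine ⟨⟨?_, fun x t hxt => ?_⟩, fun x t => ?_⟩
  · refine stronglyMeasurable_of_tendsto (f := fun n p => ∑ i ∈ Finset.range n, G i p.1 p.2)
      Filter.atTop (fun n => ?_) ?_
    · exact Finset.stronglyMeasurable_fun_sum (f := fun i => Function.uncurry (G i)) _
        fun i _ => (hG i).measurable
    · exact tendsto_pi_nhds.2 fun p =>
        (IsBoundedKernel.summable hG hc p.1 p.2).hasSum.tendsto_sum_nat
  · simp [fun n => (hG n).support x t hxt]
  · rw [← tsum_mul_right]
    exact tsum_of_norm_bounded (hc.mul_right _).hasSum fun n => (hG n).bound x t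

theorem volterra_tsum (hσm : StronglyMeasurable σ) (hσ : Integrable σ)
    (hG : ∀ n, IsBoundedKernel σ (c n) (G n)) (hc : Summable c) (ε : ℝ) :
    volterra σ ε (fun x t => ∑' n, G n x t)
      = fun x t => ∑' n, volterra σ ε (G n) x t := by
  funext x t
  have hsum := hasSum_integral_of_summable_integral_norm
    (fun n => (hG n).integrableOn hσm hσ ε x t)
    (((hc.div_const 2).mul_right _).of_nonneg_of_le
      (fun n => integral_nonneg fun _ => norm_nonneg _)
      fun n => (hG n).integral_norm_le hσ ε x t)
  simp only [tsum_mul_left] at hsum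
  exact hsum.tsum_eq.symm

end Series

end IsBoundedKernel

/-! ### The first-order kernel -/

/-- The first term in the expansion of the Schrödinger kernel in powers of `σ`. It is the only
unbounded one, and its exponential transform is `∫₀ˣ σ(s) e^{iρ(2s - x)} ds`. -/
noncomputable def firstKernel (σ : ℝ → ℂ) (x t : ℝ) : ℂ :=
  if |t| ≤ x then 1 / 2 * σ ((x + t) / 2) else 0

section FirstKernel

variable {σ : ℝ → ℂ}

theorem isConeKernel_firstKernel (hσm : StronglyMeasurable σ) : IsConeKernel (firstKernel σ) := by
  refine ⟨?_, fun x t hxt => if_neg hxt.not_ge⟩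
  have hcone : MeasurableSet {p : ℝ × ℝ | |p.2| ≤ p.1} :=
    (isClosed_le continuous_snd.abs continuous_fst).measurableSet
  exact StronglyMeasurable.ite hcone
    ((hσm.comp_measurable (g := fun p : ℝ × ℝ => (p.1 + p.2) / 2) (by fun_prop)).const_mul (1 / 2))
    stronglyMeasurable_const

theorem norm_firstKernel_le (σ : ℝ → ℂ) (x t : ℝ) :
    ‖firstKernel σ x t‖ ≤ 1 / 2 * ‖σ ((x + t) / 2)‖ := by
  rw [firstKernel]
  split_ifs
  · simp
  · simp

theorem norm_mul_firstKernel_le (σ : ℝ → ℂ) (x t s : ℝ) :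
    ‖σ s * firstKernel σ s (t + -1 * (x - s))‖
      ≤ 1 / 4 * ‖σ s‖ ^ 2 + 1 / 4 * ‖σ (s + (t - x) / 2)‖ ^ 2 := by
  have hle := norm_firstKernel_le σ s (t + -1 * (x - s))
  rw [show (s + (t + -1 * (x - s))) / 2 = s + (t - x) / 2 by ring] at hle
  rw [norm_mul]
  calc ‖σ s‖ * ‖firstKernel σ s (t + -1 * (x - s))‖
      ≤ ‖σ s‖ * (1 / 2 * ‖σ (s + (t - x) / 2)‖) :=
        mul_le_mul_of_nonneg_left hle (norm_nonneg (σ s))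
    _ ≤ _ := by linarith [two_mul_le_add_sq ‖σ s‖ ‖σ (s + (t - x) / 2)‖]

theorem integrable_sq_add_sq (hσ : MemLp σ 2) (c : ℝ) :
    Integrable fun s => 1 / 4 * ‖σ s‖ ^ 2 + 1 / 4 * ‖σ (s + c)‖ ^ 2 :=
  have hsq := (memLp_two_iff_integrable_sq_norm hσ.1).1 hσ
  (hsq.const_mul _).add ((hsq.comp_add_right c).const_mul _)

theorem integrableOn_mul_firstKernel (hσm : StronglyMeasurable σ) (hσ : MemLp σ 2) (x t : ℝ) :
    IntegrableOn (fun s => σ s * firstKernel σ s (t + -1 * (x - s))) (Ioc 0 x) :=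
  (integrable_sq_add_sq hσ ((t - x) / 2)).restrict.mono'
    ((isConeKernel_firstKernel hσm).stronglyMeasurable_mul_comp_shear hσm
      (-1) x t).aestronglyMeasurable
    (.of_forall fun s => norm_mul_firstKernel_le σ x t s)

theorem norm_volterra_firstKernel_le (hσ : MemLp σ 2) (x t : ℝ) :
    ‖volterra σ (-1) (firstKernel σ) x t‖ ≤ 1 / 2 * ∫ s, ‖σ s‖ ^ 2 := by
  have hsq := (memLp_two_iff_integrable_sq_norm hσ.1).1 hσ
  have hdom := integrable_sq_add_sq hσ ((t - x) / 2)
  calc ‖volterra σ (-1) (firstKernel σ) x t‖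
      ≤ ∫ s in Ioc 0 x, ‖σ s * firstKernel σ s (t + -1 * (x - s))‖ :=
        norm_integral_le_integral_norm _
    _ ≤ ∫ s in Ioc 0 x, (1 / 4 * ‖σ s‖ ^ 2 + 1 / 4 * ‖σ (s + (t - x) / 2)‖ ^ 2) :=
        integral_mono_of_nonneg (.of_forall fun _ => norm_nonneg _) hdom.restrict
          (.of_forall fun s => norm_mul_firstKernel_le σ x t s)
    _ ≤ ∫ s, (1 / 4 * ‖σ s‖ ^ 2 + 1 / 4 * ‖σ (s + (t - x) / 2)‖ ^ 2) :=
        setIntegral_le_integral hdom (.of_forall fun _ => by positivity)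
    _ = 1 / 2 * ∫ s, ‖σ s‖ ^ 2 := by
        rw [integral_add (hsq.const_mul _) ((hsq.comp_add_right _).const_mul _),
          integral_const_mul, integral_const_mul,
          integral_add_right_eq_self (fun s => ‖σ s‖ ^ 2)]
        ring

theorem isBoundedKernel_volterra_firstKernel (hσm : StronglyMeasurable σ) (hσ : MemLp σ 2) :
    IsBoundedKernel σ (1 / 2 * ∫ s, ‖σ s‖ ^ 2) (volterra σ (-1) (firstKernel σ)) := by
  refine ⟨(isConeKernel_firstKernel hσm).volterra hσm (by simp), fun x t => ?_⟩
  exact (norm_volterra_firstKernel_le hσ x t).trans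
    (le_mul_of_one_le_right (by positivity) (one_le_volterraWeight σ x))

end FirstKernel

/-! ### The Neumann series -/

/-- The terms of even order `2 n + 2` in the expansion of the Schrödinger kernel in powers
of `σ`. -/
noncomputable def neumannTerm (σ : ℝ → ℂ) : ℕ → ℝ → ℝ → ℂ
  | 0 => volterra σ (-1) (firstKernel σ)
  | n + 1 => volterra σ (-1) (volterra σ 1 (neumannTerm σ n))

/-- The part of even order of the Schrödinger kernel. -/
noncomputable def evenKernel (σ : ℝ → ℂ) (x t : ℝ) : ℂ := ∑' n, neumannTerm σ n x t

/-- The part of odd order of the Schrödinger kernel. -/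
noncomputable def oddKernel (σ : ℝ → ℂ) (x t : ℝ) : ℂ :=
  firstKernel σ x t + volterra σ 1 (evenKernel σ) x t

section Neumann

variable {σ : ℝ → ℂ}

theorem isBoundedKernel_neumannTerm (hσm : StronglyMeasurable σ) (hσ : Integrable σ)
    (hσ2 : MemLp σ 2) (n : ℕ) :
    IsBoundedKernel σ ((1 / 2 * ∫ s, ‖σ s‖ ^ 2) * (1 / 4) ^ n) (neumannTerm σ n) := by
  induction n with
  | zero =>
    rw [pow_zero, mul_one]
    exact isBoundedKernel_volterra_firstKernel hσm hσ2
  | succ n ih =>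
    have hstep := (ih.volterra hσm hσ (ε := 1) (by simp)).volterra hσm hσ (ε := -1) (by simp)
    rwa [div_div, ← mul_one_div, mul_assoc, show (1 / 4 : ℝ) ^ n * (1 / (2 * 2)) = (1 / 4) ^ (n + 1)
      by rw [pow_succ]; norm_num] at hstep

theorem summable_neumannBound (C : ℝ) : Summable fun n : ℕ => C * (1 / 4 : ℝ) ^ n :=
  (summable_geometric_of_lt_one (by norm_num) (by norm_num)).mul_left C

theorem isBoundedKernel_evenKernel (hσm : StronglyMeasurable σ) (hσ : Integrable σ)
    (hσ2 : MemLp σ 2) :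
    IsBoundedKernel σ (∑' n : ℕ, (1 / 2 * ∫ s, ‖σ s‖ ^ 2) * (1 / 4) ^ n) (evenKernel σ) :=
  .tsum (isBoundedKernel_neumannTerm hσm hσ hσ2) (summable_neumannBound _)

theorem evenKernel_eq_volterra (hσm : StronglyMeasurable σ) (hσ : Integrable σ)
    (hσ2 : MemLp σ 2) : evenKernel σ = volterra σ (-1) (oddKernel σ) := by
  have hG := isBoundedKernel_neumannTerm hσm hσ hσ2
  have hc := summable_neumannBound (1 / 2 * ∫ s, ‖σ s‖ ^ 2)
  have hVG : ∀ n, IsBoundedKernel σ _ (volterra σ 1 (neumannTerm σ n)) := fun n =>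
    (hG n).volterra hσm hσ (by simp)
  have hVeven : volterra σ 1 (evenKernel σ) = fun x t => ∑' n, volterra σ 1 (neumannTerm σ n) x t :=
    IsBoundedKernel.volterra_tsum hσm hσ hG hc 1
  funext x t
  calc evenKernel σ x t
      = volterra σ (-1) (firstKernel σ) x t
          + ∑' n, volterra σ (-1) (volterra σ 1 (neumannTerm σ n)) x t :=
        (IsBoundedKernel.summable hG hc x t).tsum_eq_zero_add
    _ = volterra σ (-1) (firstKernel σ) x t
          + volterra σ (-1) (volterra σ 1 (evenKernel σ)) x t := by
        rw [hVeven, IsBoundedKernel.volterra_tsum hσm hσ hVG (hc.div_const 2)]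
    _ = volterra σ (-1) (oddKernel σ) x t :=
        (volterra_add (integrableOn_mul_firstKernel hσm hσ2 x t)
          (((isBoundedKernel_evenKernel hσm hσ hσ2).volterra hσm hσ
            (by simp)).integrableOn hσm hσ (-1) x t)).symm

end Neumann

/-! ### Exponential transforms of kernels -/

/-- The Fourier–Laplace transform `∫ g(t) e^{iρt} dt` at a complex frequency. -/
noncomputable def expTransform (ρ : ℂ) (g : ℝ → ℂ) : ℂ :=
  ∫ t, g t * Complex.exp (Complex.I * ρ * t)

/-- A cone kernel whose slices `g x`, for `0 ≤ x ≤ ℓ`, are bounded by `M` in `L¹`; the exponential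
transforms of these slices are then bounded as well. -/
structure IsIntegrableKernel (ℓ M : ℝ) (g : ℝ → ℝ → ℂ) : Prop extends IsConeKernel g where
  integrable : ∀ x ∈ Icc 0 ℓ, Integrable (g x)
  bound : ∀ x ∈ Icc 0 ℓ, ∫ t, ‖g x t‖ ≤ M

theorem norm_mul_cexp_le (ρ z : ℂ) {t x : ℝ} (h : x < |t| → z = 0) :
    ‖z * Complex.exp (Complex.I * ρ * t)‖ ≤ Real.exp (‖ρ‖ * x) * ‖z‖ := by
  rcases lt_or_ge x |t| with hx | hx
  · simp [h hx]
  · rw [norm_mul, mul_comm]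
    refine mul_le_mul_of_nonneg_right ((Complex.norm_exp_le_exp_norm _).trans
      (Real.exp_le_exp.2 ?_)) (norm_nonneg _)
    rw [norm_mul, norm_mul, Complex.norm_I, one_mul, Complex.norm_real, Real.norm_eq_abs]
    exact mul_le_mul_of_nonneg_left hx (norm_nonneg _)

theorem expTransform_comp_add_right (ρ : ℂ) (g : ℝ → ℂ) (c : ℝ) :
    expTransform ρ (fun t => g (t + c))
      = Complex.exp (-(Complex.I * ρ * c)) * expTransform ρ g := by
  rw [expTransform, expTransform, ← integral_const_mul, ← integral_add_right_eq_self
    (fun t : ℝ => Complex.exp (-(Complex.I * ρ * c)) * (g t * Complex.exp (Complex.I * ρ * t))) c]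
  congr with t
  rw [mul_left_comm, ← Complex.exp_add]
  congr 2
  push_cast
  ring

theorem expTransform_eq_intervalIntegral (ρ : ℂ) {g : ℝ → ℂ} {a b : ℝ} (hab : a ≤ b)
    (hg : ∀ t ∉ Icc a b, g t = 0) :
    expTransform ρ g = ∫ t in a..b, g t * Complex.exp (Complex.I * ρ * t) := by
  rw [intervalIntegral.integral_of_le hab, ← integral_Icc_eq_integral_Ioc,
    setIntegral_eq_integral_of_forall_compl_eq_zero fun t ht => by rw [hg t ht, zero_mul],
    expTransform]

namespace IsIntegrableKernel

variable {σ : ℝ → ℂ} {ℓ M : ℝ} {g : ℝ → ℝ → ℂ}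

theorem integrable_mul_cexp (hg : IsIntegrableKernel ℓ M g) (ρ : ℂ) {x : ℝ} (hx : x ∈ Icc 0 ℓ) :
    Integrable fun t : ℝ => g x t * Complex.exp (Complex.I * ρ * t) :=
  ((hg.integrable x hx).norm.const_mul (Real.exp (‖ρ‖ * x))).mono'
    ((hg.slice x).aestronglyMeasurable.mul (continuous_cexp_mul ρ).aestronglyMeasurable)
    (.of_forall fun t => norm_mul_cexp_le ρ _ (hg.support x t))

theorem norm_expTransform_le (hg : IsIntegrableKernel ℓ M g) (ρ : ℂ) {x : ℝ} (hx : x ∈ Icc 0 ℓ) :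
    ‖expTransform ρ (g x)‖ ≤ Real.exp (‖ρ‖ * ℓ) * M :=
  calc ‖expTransform ρ (g x)‖ ≤ ∫ t, Real.exp (‖ρ‖ * x) * ‖g x t‖ :=
        norm_integral_le_of_norm_le ((hg.integrable x hx).norm.const_mul _)
          (.of_forall fun t => norm_mul_cexp_le ρ _ (hg.support x t))
    _ = Real.exp (‖ρ‖ * x) * ∫ t, ‖g x t‖ := integral_const_mul _ _
    _ ≤ Real.exp (‖ρ‖ * ℓ) * M := by
        gcongr
        exacts [hx.2, hg.bound x hx]

theorem stronglyMeasurable_expTransform (hg : IsIntegrableKernel ℓ M g) (ρ : ℂ) :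
    StronglyMeasurable fun x => expTransform ρ (g x) :=
  StronglyMeasurable.integral_prod_right
    (f := fun x (t : ℝ) => g x t * Complex.exp (Complex.I * ρ * t))
    (hg.measurable.mul ((continuous_cexp_mul ρ).comp continuous_snd).stronglyMeasurable)

protected theorem add {M' : ℝ} {h : ℝ → ℝ → ℂ} (hg : IsIntegrableKernel ℓ M g)
    (hh : IsIntegrableKernel ℓ M' h) : IsIntegrableKernel ℓ (M + M') fun x t => g x t + h x t := by
  refine ⟨hg.toIsConeKernel.add hh.toIsConeKernel,
    fun x hx => (hg.integrable x hx).add (hh.integrable x hx), fun x hx => ?_⟩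
  have hgx := hg.integrable x hx
  have hhx := hh.integrable x hx
  calc ∫ t, ‖g x t + h x t‖ ≤ ∫ t, (‖g x t‖ + ‖h x t‖) :=
        integral_mono (hgx.add hhx).norm (hgx.norm.add hhx.norm) fun t => norm_add_le _ _
    _ = (∫ t, ‖g x t‖) + ∫ t, ‖h x t‖ := integral_add hgx.norm hhx.norm
    _ ≤ M + M' := add_le_add (hg.bound x hx) (hh.bound x hx)

theorem expTransform_add {M' : ℝ} {h : ℝ → ℝ → ℂ} (hg : IsIntegrableKernel ℓ M g)
    (hh : IsIntegrableKernel ℓ M' h) (ρ : ℂ) {x : ℝ} (hx : x ∈ Icc 0 ℓ) :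
    expTransform ρ (fun t => g x t + h x t) = expTransform ρ (g x) + expTransform ρ (h x) := by
  simp only [expTransform, add_mul]
  exact integral_add (hg.integrable_mul_cexp ρ hx) (hh.integrable_mul_cexp ρ hx)

theorem integrable_prod_comp_shear (hσm : StronglyMeasurable σ) (hσ : Integrable σ) {ε : ℝ}
    (hε : |ε| = 1) (hg : IsIntegrableKernel ℓ M g) (ρ : ℂ) {x : ℝ} (hx : x ∈ Icc 0 ℓ) :
    Integrable (Function.uncurry fun (t s : ℝ) =>
        σ s * g s (t + ε * (x - s)) * Complex.exp (Complex.I * ρ * t))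
      (volume.prod (volume.restrict (Ioc 0 x))) := by
  set Φ : ℝ → ℝ → ℂ := fun t s => σ s * g s (t + ε * (x - s)) * Complex.exp (Complex.I * ρ * t)
  have hΦm : StronglyMeasurable (Function.uncurry Φ) :=
    ((hσm.comp_measurable measurable_snd).mul (hg.measurable.comp_measurable
      (g := fun p : ℝ × ℝ => (p.2, p.1 + ε * (x - p.2))) (by fun_prop))).mul
      ((continuous_cexp_mul ρ).comp continuous_fst).stronglyMeasurable
  have hIcc : ∀ s ∈ Ioc 0 x, s ∈ Icc 0 ℓ := fun s hs => ⟨hs.1.le, hs.2.trans hx.2⟩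
  have hΦle : ∀ s ∈ Ioc 0 x, ∀ t,
      ‖Φ t s‖ ≤ Real.exp (‖ρ‖ * x) * (‖σ s‖ * ‖g s (t + ε * (x - s))‖) := fun s hs t => by
    rw [← norm_mul]
    refine norm_mul_cexp_le ρ _ fun hxt => ?_
    rw [hg.comp_shear_eq_zero hε hs.2 hxt, mul_zero]
  have hdom : ∀ s ∈ Ioc 0 x, Integrable fun t =>
      Real.exp (‖ρ‖ * x) * (‖σ s‖ * ‖g s (t + ε * (x - s))‖) := fun s hs =>
    ((((hg.integrable s (hIcc s hs)).comp_add_right (ε * (x - s))).norm).const_mul _).const_mul _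
  refine (integrable_prod_iff' hΦm.aestronglyMeasurable).2 ⟨?_, ?_⟩
  · filter_upwards [ae_restrict_mem measurableSet_Ioc] with s hs
    exact (hdom s hs).mono' (hΦm.comp_measurable measurable_prodMk_right).aestronglyMeasurable
      (.of_forall (hΦle s hs))
  · refine (hσ.norm.const_mul (Real.exp (‖ρ‖ * x) * M)).restrict.mono'
      hΦm.norm.integral_prod_left'.aestronglyMeasurable ?_
    filter_upwards [ae_restrict_mem measurableSet_Ioc] with s hs
    rw [Real.norm_of_nonneg (integral_nonneg fun _ => norm_nonneg _)]
    calc ∫ t, ‖Φ t s‖ ≤ ∫ t, Real.exp (‖ρ‖ * x) * (‖σ s‖ * ‖g s (t + ε * (x - s))‖) :=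
          integral_mono_of_nonneg (.of_forall fun _ => norm_nonneg _) (hdom s hs)
            (.of_forall (hΦle s hs))
      _ = Real.exp (‖ρ‖ * x) * (‖σ s‖ * ∫ t, ‖g s t‖) := by
          rw [integral_const_mul, integral_const_mul,
            integral_add_right_eq_self (fun t => ‖g s t‖)]
      _ ≤ Real.exp (‖ρ‖ * x) * (‖σ s‖ * M) := by
          gcongr
          exact hg.bound s (hIcc s hs)
      _ = Real.exp (‖ρ‖ * x) * M * ‖σ s‖ := by ring

theorem expTransform_volterra (hσm : StronglyMeasurable σ) (hσ : Integrable σ) {ε : ℝ}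
    (hε : |ε| = 1) (hg : IsIntegrableKernel ℓ M g) (ρ : ℂ) {x : ℝ} (hx : x ∈ Icc 0 ℓ) :
    expTransform ρ (volterra σ ε g x) = ∫ s in Ioc 0 x,
      σ s * Complex.exp (-(Complex.I * ρ * (ε * (x - s) : ℝ))) * expTransform ρ (g s) :=
  calc expTransform ρ (volterra σ ε g x)
      = ∫ t : ℝ, ∫ s in Ioc 0 x,
          σ s * g s (t + ε * (x - s)) * Complex.exp (Complex.I * ρ * t) := by
        simp only [expTransform, volterra, integral_mul_const]
    _ = ∫ s in Ioc 0 x, ∫ t : ℝ,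
          σ s * g s (t + ε * (x - s)) * Complex.exp (Complex.I * ρ * t) :=
        integral_integral_swap (hg.integrable_prod_comp_shear hσm hσ hε ρ hx)
    _ = _ := by
        congr with s
        simp only [mul_assoc (σ s)]
        rw [integral_const_mul, ← expTransform_comp_add_right, expTransform]

end IsIntegrableKernel

namespace IsBoundedKernel

variable {σ : ℝ → ℂ} {C : ℝ} {g : ℝ → ℝ → ℂ}

theorem norm_le_indicator (hσ : Integrable σ) (hg : IsBoundedKernel σ C g) {x ℓ : ℝ}
    (hx : x ≤ ℓ) (t : ℝ) :
    ‖g x t‖ ≤ (Icc (-ℓ) ℓ).indicator (fun _ => C * volterraWeight σ ℓ) t := by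
  by_cases ht : t ∈ Icc (-ℓ) ℓ
  · rw [indicator_of_mem ht]
    exact hg.norm_le hσ hx t
  · rw [indicator_of_notMem ht, hg.eq_zero_of_notMem_Icc fun h =>
      ht (Icc_subset_Icc (neg_le_neg hx) hx h), norm_zero]

theorem memLp_slice (hσ : Integrable σ) (hg : IsBoundedKernel σ C g) (p : ENNReal) (x : ℝ) :
    MemLp (g x) p :=
  ((memLp_indicator_iff_restrict measurableSet_Icc).2
    (memLp_const (μ := volume.restrict (Icc (-x) x)) (C * volterraWeight σ x))).mono'
    (hg.slice x).aestronglyMeasurable (.of_forall fun t => hg.norm_le_indicator hσ le_rfl t)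

theorem exists_isIntegrableKernel (hσ : Integrable σ) (hg : IsBoundedKernel σ C g) (ℓ : ℝ) :
    ∃ M, IsIntegrableKernel ℓ M g := by
  have hdom : Integrable ((Icc (-ℓ) ℓ).indicator fun _ => C * volterraWeight σ ℓ) :=
    (integrable_indicator_iff measurableSet_Icc).2 (integrableOn_const (by simp))
  exact ⟨_, hg.toIsConeKernel, fun x _ => memLp_one_iff_integrable.1 (hg.memLp_slice hσ 1 x),
    fun x hx => integral_mono_of_nonneg (.of_forall fun _ => norm_nonneg _) hdom
      (.of_forall fun t => hg.norm_le_indicator hσ hx.2 t)⟩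

theorem memLp_triangle (hσ : Integrable σ) (hg : IsBoundedKernel σ C g) (p : ENNReal) (ℓ : ℝ) :
    MemLp (Function.uncurry g) p (volume.restrict (triangle ℓ)) :=
  memLp_triangle_of_norm_le hg.measurable.aestronglyMeasurable
    (fun z hz => hg.norm_le hσ hz.2.1 z.2) p

end IsBoundedKernel

theorem memLp_two_triangle_of_slices {g : ℝ → ℝ → ℂ} {ℓ N : ℝ}
    (hgm : StronglyMeasurable (Function.uncurry g)) (hg : ∀ x, MemLp (g x) 2)
    (hN : ∀ x, ∫ t, ‖g x t‖ ^ 2 ≤ N) :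
    MemLp (Function.uncurry g) 2 (volume.restrict (triangle ℓ)) := by
  have hsqm : StronglyMeasurable fun p => ‖Function.uncurry g p‖ ^ 2 := hgm.norm.pow 2
  have hstrip : Integrable (fun p : ℝ × ℝ => ‖Function.uncurry g p‖ ^ 2)
      ((volume.restrict (Icc 0 ℓ)).prod volume) := by
    refine (integrable_prod_iff hsqm.aestronglyMeasurable).2
      ⟨.of_forall fun x => (memLp_two_iff_integrable_sq_norm (hg x).1).1 (hg x), ?_⟩
    refine (integrable_const N).mono' hsqm.norm.integral_prod_right'.aestronglyMeasurable
      (.of_forall fun x => ?_)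
    rw [Real.norm_of_nonneg (integral_nonneg fun _ => norm_nonneg _)]
    simpa using hN x
  have hsub : triangle ℓ ⊆ Icc 0 ℓ ×ˢ (univ : Set ℝ) := fun p hp => ⟨⟨hp.1, hp.2.1⟩, mem_univ _⟩
  have hprod : (volume.restrict (Icc 0 ℓ)).prod (volume : Measure ℝ)
      = volume.restrict (Icc 0 ℓ ×ˢ (univ : Set ℝ)) := by
    rw [Measure.volume_eq_prod, ← Measure.prod_restrict, Measure.restrict_univ]
  rw [hprod] at hstrip
  exact (memLp_two_iff_integrable_sq_norm hgm.aestronglyMeasurable).2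
    (hstrip.mono_measure (Measure.restrict_mono hsub le_rfl))

theorem integrable_comp_half {E : Type*} [NormedAddCommGroup E] {u : ℝ → E} (hu : Integrable u)
    (x : ℝ) : Integrable fun t => u ((x + t) / 2) :=
  (hu.comp_div two_ne_zero).comp_add_left x

theorem integral_comp_half {E : Type*} [NormedAddCommGroup E] [NormedSpace ℝ E] (u : ℝ → E)
    (x : ℝ) : ∫ t, u ((x + t) / 2) = (2 : ℝ) • ∫ s, u s := by
  rw [integral_add_left_eq_self (fun t => u (t / 2)) x, Measure.integral_comp_div]
  simp

section FirstKernel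

variable {σ : ℝ → ℂ}

theorem isIntegrableKernel_firstKernel (ℓ : ℝ) (hσm : StronglyMeasurable σ) (hσ : Integrable σ) :
    IsIntegrableKernel ℓ (∫ s, ‖σ s‖) (firstKernel σ) := by
  have hcone := isConeKernel_firstKernel hσm
  have hdom : ∀ x, Integrable fun t => 1 / 2 * ‖σ ((x + t) / 2)‖ := fun x =>
    (integrable_comp_half hσ.norm x).const_mul _
  refine ⟨hcone, fun x _ => (hdom x).mono' (hcone.slice x).aestronglyMeasurable
    (.of_forall fun t => norm_firstKernel_le σ x t), fun x _ => ?_⟩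
  calc ∫ t, ‖firstKernel σ x t‖ ≤ ∫ t, 1 / 2 * ‖σ ((x + t) / 2)‖ :=
        integral_mono_of_nonneg (.of_forall fun _ => norm_nonneg _) (hdom x)
          (.of_forall fun t => norm_firstKernel_le σ x t)
    _ = ∫ s, ‖σ s‖ := by
        rw [integral_const_mul, integral_comp_half (fun s => ‖σ s‖), smul_eq_mul]
        ring

theorem expTransform_firstKernel (hσm : StronglyMeasurable σ) (ρ : ℂ) {x : ℝ} (hx : 0 ≤ x) :
    expTransform ρ (firstKernel σ x)
      = ∫ s in Ioc 0 x, σ s * Complex.exp (Complex.I * ρ * (2 * s - x)) := by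
  rw [expTransform_eq_intervalIntegral ρ (by linarith)
    fun t => (isConeKernel_firstKernel hσm).eq_zero_of_notMem_Icc,
    ← intervalIntegral.integral_of_le hx]
  have hsubst := intervalIntegral.integral_comp_add_div (a := -x) (b := x) (c := 2)
    (fun s : ℝ => σ s * Complex.exp (Complex.I * ρ * (2 * s - x))) two_ne_zero (x / 2)
  rw [show x / 2 + -x / 2 = 0 by ring, show x / 2 + x / 2 = x by ring] at hsubst
  calc ∫ t in (-x)..x, firstKernel σ x t * Complex.exp (Complex.I * ρ * t)
      = ∫ t in (-x)..x, (1 / 2 : ℂ) * (σ (x / 2 + t / 2) *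
          Complex.exp (Complex.I * ρ * (2 * (x / 2 + t / 2 : ℝ) - x))) := by
        refine intervalIntegral.integral_congr fun t ht => ?_
        rw [uIcc_of_le (by linarith)] at ht
        simp only [firstKernel, if_pos (abs_le.2 ht), mul_assoc, add_div]
        push_cast
        ring_nf
    _ = ∫ s in (0 : ℝ)..x, σ s * Complex.exp (Complex.I * ρ * (2 * s - x)) := by
        rw [intervalIntegral.integral_const_mul, hsubst, Complex.real_smul]
        push_cast
        ring

theorem norm_sq_firstKernel_le (σ : ℝ → ℂ) (x t : ℝ) :
    ‖firstKernel σ x t‖ ^ 2 ≤ 1 / 4 * ‖σ ((x + t) / 2)‖ ^ 2 :=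
  (pow_le_pow_left₀ (norm_nonneg _) (norm_firstKernel_le σ x t) 2).trans_eq (by ring)

theorem memLp_two_firstKernel_slice (hσm : StronglyMeasurable σ) (hσ : MemLp σ 2) (x : ℝ) :
    MemLp (firstKernel σ x) 2 := by
  have hm := ((isConeKernel_firstKernel hσm).slice x).aestronglyMeasurable (μ := volume)
  have hsq := (memLp_two_iff_integrable_sq_norm hσ.1).1 hσ
  refine (memLp_two_iff_integrable_sq_norm hm).2 <|
    ((integrable_comp_half hsq x).const_mul (1 / 4)).mono' (hm.norm.pow 2) (.of_forall fun t => ?_)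
  rw [Real.norm_of_nonneg (by positivity)]
  exact norm_sq_firstKernel_le σ x t

theorem memLp_two_firstKernel_triangle (hσm : StronglyMeasurable σ) (hσ : MemLp σ 2) (ℓ : ℝ) :
    MemLp (Function.uncurry (firstKernel σ)) 2 (volume.restrict (triangle ℓ)) := by
  have hsq := (memLp_two_iff_integrable_sq_norm hσ.1).1 hσ
  refine memLp_two_triangle_of_slices (isConeKernel_firstKernel hσm).measurable
    (memLp_two_firstKernel_slice hσm hσ) (N := 1 / 2 * ∫ s, ‖σ s‖ ^ 2) fun x => ?_
  calc ∫ t, ‖firstKernel σ x t‖ ^ 2 ≤ ∫ t, 1 / 4 * ‖σ ((x + t) / 2)‖ ^ 2 :=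
        integral_mono_of_nonneg (.of_forall fun _ => by positivity)
          ((integrable_comp_half hsq x).const_mul _)
          (.of_forall fun t => norm_sq_firstKernel_le σ x t)
    _ = 1 / 2 * ∫ s, ‖σ s‖ ^ 2 := by
        rw [integral_const_mul, integral_comp_half (fun s => ‖σ s‖ ^ 2), smul_eq_mul]
        ring

end FirstKernel

/-! ### The Dirac system and the Schrödinger kernel -/

/-- The Dirac system `A' = iρA + σB`, `B' = -iρB + σA`, into which the Schrödinger system is
transformed by `y = A + B`, `w = iρ(A - B)`. -/
structure IsDiracSystem (ℓ : ℝ) (σ : ℝ → ℂ) (ρ : ℂ) (A B : ℝ → ℂ) : Prop where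
  fst : IsPrimitiveOn 0 ℓ A fun x => Complex.I * ρ * A x + σ x * B x
  snd : IsPrimitiveOn 0 ℓ B fun x => -(Complex.I * ρ * B x) + σ x * A x
  fst_zero : A 0 = 1
  snd_zero : B 0 = 0

theorem IsDiracSystem.isSchrodingerSystem {ℓ : ℝ} {σ : ℝ → ℂ} {ρ : ℂ} {A B : ℝ → ℂ}
    (h : IsDiracSystem ℓ σ ρ A B) :
    IsSchrodingerSystem ℓ σ ρ (fun x => A x + B x) fun x => Complex.I * ρ * (A x - B x) := by
  refine ⟨(h.fst.add h.snd).congr_deriv (.of_forall fun x => by ring),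
    ((h.fst.sub h.snd).const_mul (Complex.I * ρ)).congr_deriv (.of_forall fun x => ?_),
    by rw [h.fst_zero, h.snd_zero, add_zero], by rw [h.fst_zero, h.snd_zero, sub_zero, mul_one]⟩
  linear_combination ρ ^ 2 * (A x + B x) * Complex.I_sq

theorem IsSchrodingerSystem.congr_coeff {ℓ : ℝ} {σ τ : ℝ → ℂ} {ρ : ℂ} {y w : ℝ → ℂ}
    (h : IsSchrodingerSystem ℓ σ ρ y w) (hστ : σ =ᵐ[volume.restrict (Ioo 0 ℓ)] τ) :
    IsSchrodingerSystem ℓ τ ρ y w := by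
  refine ⟨h.fst.congr_deriv ?_, h.snd.congr_deriv ?_, h.fst_zero, h.snd_zero⟩ <;>
    filter_upwards [hστ] with x hx <;> rw [hx]

theorem isPrimitiveOn_of_duhamel {ℓ : ℝ} (hℓ : 0 ≤ ℓ) {κ c : ℂ} {u h : ℝ → ℂ}
    (hh : IntervalIntegrable h volume 0 ℓ)
    (hu : ∀ x ∈ Icc 0 ℓ, u x = c * Complex.exp (Complex.I * κ * x) +
      ∫ s in Ioc 0 x, Complex.exp (Complex.I * κ * (x - s)) * h s) :
    IsPrimitiveOn 0 ℓ u fun x => Complex.I * κ * u x + h x := by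
  have hexp : ∀ x s : ℝ, Complex.exp (Complex.I * κ * (x - s)) =
      Complex.exp (Complex.I * κ * x) * Complex.exp (Complex.I * -κ * s) := fun x s => by
    rw [← Complex.exp_add]
    ring_nf
  have hinv : ∀ x : ℝ, Complex.exp (Complex.I * κ * x) * Complex.exp (Complex.I * -κ * x) = 1 :=
    fun x => by rw [← hexp, sub_self, mul_zero, Complex.exp_zero]
  have hint := (hh.continuousOn_mul (continuous_cexp_mul (-κ)).continuousOn)
  have hu_eq : EqOn (fun x : ℝ => Complex.exp (Complex.I * κ * x) *
      (c + ∫ s in (0 : ℝ)..x, Complex.exp (Complex.I * -κ * s) * h s)) u (Icc 0 ℓ) := fun x hx => by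
    rw [hu x hx, ← intervalIntegral.integral_of_le hx.1]
    simp only [hexp, mul_assoc (Complex.exp _), intervalIntegral.integral_const_mul]
    ring
  refine (((isPrimitiveOn_cexp_mul hℓ κ).mul (.const_add_integral hℓ c hint)).congr
    hu_eq).congr_deriv ?_
  filter_upwards [ae_restrict_mem measurableSet_Ioo] with x hx
  rw [← hu_eq (Ioo_subset_Icc_self hx)]
  linear_combination h x * hinv x

theorem IsIntegrableKernel.integrableOn_mul_expTransform {σ : ℝ → ℂ} {ℓ M : ℝ} {g : ℝ → ℝ → ℂ}
    (hg : IsIntegrableKernel ℓ M g) (hσ : Integrable σ) (ρ : ℂ) :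
    IntegrableOn (fun s => σ s * expTransform ρ (g s)) (Icc 0 ℓ) :=
  hσ.integrableOn.mul_bdd (c := Real.exp (‖ρ‖ * ℓ) * M)
    (hg.stronglyMeasurable_expTransform ρ).aestronglyMeasurable
    ((ae_restrict_iff' measurableSet_Icc).2 (.of_forall fun _ hx => hg.norm_expTransform_le ρ hx))

/-- The transmutation kernel of the Schrödinger operator whose potential is the distribution
`σ' + σ²`. -/
noncomputable def schrodingerKernel (σ : ℝ → ℂ) (x t : ℝ) : ℂ := evenKernel σ x t + oddKernel σ x t

section SchrodingerKernel

variable {σ : ℝ → ℂ} (hσm : StronglyMeasurable σ) (hσ : Integrable σ) (hσ2 : MemLp σ 2)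
include hσm hσ hσ2

theorem exists_isIntegrableKernel_evenKernel (ℓ : ℝ) : ∃ M, IsIntegrableKernel ℓ M (evenKernel σ) :=
  (isBoundedKernel_evenKernel hσm hσ hσ2).exists_isIntegrableKernel hσ ℓ

theorem exists_isBoundedKernel_volterra_evenKernel :
    ∃ C, IsBoundedKernel σ C (volterra σ 1 (evenKernel σ)) :=
  ⟨_, (isBoundedKernel_evenKernel hσm hσ hσ2).volterra hσm hσ (by simp)⟩

theorem exists_isIntegrableKernel_oddKernel (ℓ : ℝ) :
    ∃ M, IsIntegrableKernel ℓ M (oddKernel σ) := by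
  obtain ⟨C, hC⟩ := exists_isBoundedKernel_volterra_evenKernel hσm hσ hσ2
  obtain ⟨M, hM⟩ := hC.exists_isIntegrableKernel hσ ℓ
  exact ⟨_, (isIntegrableKernel_firstKernel ℓ hσm hσ).add hM⟩

theorem expTransform_evenKernel (ρ : ℂ) {x : ℝ} (hx : 0 ≤ x) :
    expTransform ρ (evenKernel σ x) = ∫ s in Ioc 0 x, Complex.exp (Complex.I * ρ * (x - s)) *
      (σ s * expTransform ρ (oddKernel σ s)) := by
  obtain ⟨M, hodd⟩ := exists_isIntegrableKernel_oddKernel hσm hσ hσ2 x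
  rw [evenKernel_eq_volterra hσm hσ hσ2,
    hodd.expTransform_volterra hσm hσ (by simp) ρ (right_mem_Icc.2 hx)]
  congr with s
  push_cast
  ring_nf

theorem expTransform_oddKernel (ρ : ℂ) {x : ℝ} (hx : 0 ≤ x) :
    expTransform ρ (oddKernel σ x) = ∫ s in Ioc 0 x, Complex.exp (Complex.I * -ρ * (x - s)) *
      (σ s * (Complex.exp (Complex.I * ρ * s) + expTransform ρ (evenKernel σ s))) := by
  obtain ⟨M, heven⟩ := exists_isIntegrableKernel_evenKernel hσm hσ hσ2 x
  obtain ⟨C, hC⟩ := exists_isBoundedKernel_volterra_evenKernel hσm hσ hσ2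
  obtain ⟨M', hM'⟩ := hC.exists_isIntegrableKernel hσ x
  have hexp : Continuous fun s : ℝ => Complex.exp (Complex.I * -ρ * (x - s)) := by fun_prop
  have hfirst : IntegrableOn (fun s : ℝ => Complex.exp (Complex.I * -ρ * (x - s)) *
      (σ s * Complex.exp (Complex.I * ρ * s))) (Icc 0 x) :=
    (hσ.integrableOn.mul_continuousOn (continuous_cexp_mul ρ).continuousOn
      isCompact_Icc).continuousOn_mul hexp.continuousOn isCompact_Icc
  have hnext : IntegrableOn (fun s : ℝ => Complex.exp (Complex.I * -ρ * (x - s)) *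
      (σ s * expTransform ρ (evenKernel σ s))) (Icc 0 x) :=
    (heven.integrableOn_mul_expTransform hσ ρ).continuousOn_mul hexp.continuousOn isCompact_Icc
  have hx' : x ∈ Icc 0 x := right_mem_Icc.2 hx
  calc expTransform ρ (oddKernel σ x)
      = (∫ s in Ioc 0 x, σ s * Complex.exp (Complex.I * ρ * (2 * s - x))) +
          ∫ s in Ioc 0 x, σ s * Complex.exp (-(Complex.I * ρ * (1 * (x - s) : ℝ))) *
            expTransform ρ (evenKernel σ s) := by
        rw [← expTransform_firstKernel hσm ρ hx,
          ← heven.expTransform_volterra hσm hσ (by simp) ρ hx',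
          ← (isIntegrableKernel_firstKernel x hσm hσ).expTransform_add hM' ρ hx']
        rfl
    _ = (∫ s in Ioc 0 x, Complex.exp (Complex.I * -ρ * (x - s)) *
          (σ s * Complex.exp (Complex.I * ρ * s))) +
          ∫ s in Ioc 0 x, Complex.exp (Complex.I * -ρ * (x - s)) *
            (σ s * expTransform ρ (evenKernel σ s)) := by
        congr 2 with s
        · rw [mul_left_comm, ← Complex.exp_add]
          ring_nf
        · push_cast
          ring_nf
    _ = _ := by
        rw [← integral_add (hfirst.mono_set Ioc_subset_Icc_self)
          (hnext.mono_set Ioc_subset_Icc_self)]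
        simp only [mul_add]

theorem isDiracSystem_expTransform {ℓ : ℝ} (hℓ : 0 ≤ ℓ) (ρ : ℂ) :
    IsDiracSystem ℓ σ ρ
      (fun x => Complex.exp (Complex.I * ρ * x) + expTransform ρ (evenKernel σ x))
      fun x => expTransform ρ (oddKernel σ x) := by
  obtain ⟨M, heven⟩ := exists_isIntegrableKernel_evenKernel hσm hσ hσ2 ℓ
  obtain ⟨M', hodd⟩ := exists_isIntegrableKernel_oddKernel hσm hσ hσ2 ℓ
  have hA : IntervalIntegrable (fun x => σ x *
      (Complex.exp (Complex.I * ρ * x) + expTransform ρ (evenKernel σ x))) volume 0 ℓ := by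
    rw [intervalIntegrable_iff_integrableOn_Icc_of_le hℓ]
    simp only [mul_add]
    exact (hσ.integrableOn.mul_continuousOn (continuous_cexp_mul ρ).continuousOn
      isCompact_Icc).add (heven.integrableOn_mul_expTransform hσ ρ)
  have hB : IntervalIntegrable (fun x => σ x * expTransform ρ (oddKernel σ x)) volume 0 ℓ := by
    rw [intervalIntegrable_iff_integrableOn_Icc_of_le hℓ]
    exact hodd.integrableOn_mul_expTransform hσ ρ
  refine ⟨isPrimitiveOn_of_duhamel hℓ (c := 1) hB fun x hx => ?_,
    (isPrimitiveOn_of_duhamel hℓ (κ := -ρ) (c := 0) hA fun x hx => ?_).congr_deriv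
      (.of_forall fun x => by ring), ?_, ?_⟩
  · rw [expTransform_evenKernel hσm hσ hσ2 ρ hx.1, one_mul]
  · rw [expTransform_oddKernel hσm hσ hσ2 ρ hx.1, zero_mul, zero_add]
  · simp [expTransform_evenKernel hσm hσ hσ2 ρ le_rfl]
  · simp [expTransform_oddKernel hσm hσ hσ2 ρ le_rfl]

theorem exists_isIntegrableKernel_schrodingerKernel (ℓ : ℝ) :
    ∃ M, IsIntegrableKernel ℓ M (schrodingerKernel σ) := by
  obtain ⟨M, heven⟩ := exists_isIntegrableKernel_evenKernel hσm hσ hσ2 ℓ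
  obtain ⟨M', hodd⟩ := exists_isIntegrableKernel_oddKernel hσm hσ hσ2 ℓ
  exact ⟨_, heven.add hodd⟩

theorem memLp_two_schrodingerKernel_slice (x : ℝ) : MemLp (schrodingerKernel σ x) 2 := by
  obtain ⟨C, hC⟩ := exists_isBoundedKernel_volterra_evenKernel hσm hσ hσ2
  exact ((isBoundedKernel_evenKernel hσm hσ hσ2).memLp_slice hσ 2 x).add
    ((memLp_two_firstKernel_slice hσm hσ2 x).add (hC.memLp_slice hσ 2 x))

theorem memLp_two_schrodingerKernel_triangle (ℓ : ℝ) :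
    MemLp (Function.uncurry (schrodingerKernel σ)) 2 (volume.restrict (triangle ℓ)) := by
  obtain ⟨C, hC⟩ := exists_isBoundedKernel_volterra_evenKernel hσm hσ hσ2
  exact ((isBoundedKernel_evenKernel hσm hσ hσ2).memLp_triangle hσ 2 ℓ).add
    ((memLp_two_firstKernel_triangle hσm hσ2 ℓ).add (hC.memLp_triangle hσ 2 ℓ))

theorem expTransform_evenKernel_add_oddKernel (ρ : ℂ) {x : ℝ} (hx : 0 ≤ x) :
    expTransform ρ (evenKernel σ x) + expTransform ρ (oddKernel σ x) =
      ∫ t in (-x)..x, schrodingerKernel σ x t * Complex.exp (Complex.I * ρ * t) := by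
  obtain ⟨M, heven⟩ := exists_isIntegrableKernel_evenKernel hσm hσ hσ2 x
  obtain ⟨M', hodd⟩ := exists_isIntegrableKernel_oddKernel hσm hσ hσ2 x
  rw [← heven.expTransform_add hodd ρ (right_mem_Icc.2 hx)]
  exact expTransform_eq_intervalIntegral ρ (by linarith)
    fun t ht => (heven.add hodd).eq_zero_of_notMem_Icc ht

end SchrodingerKernel

theorem exists_isSchrodingerKernel {ℓ : ℝ} {f f' : ℝ → ℂ} (hℓ : 0 < ℓ)
    (hf' : MemLp f' 2 (volume.restrict (Ioo 0 ℓ))) (hfc : ContinuousOn f (Icc 0 ℓ))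
    (hf_ne : ∀ x ∈ Icc 0 ℓ, f x ≠ 0) :
    ∃ K M, IsIntegrableKernel ℓ M K ∧ (∀ x, MemLp (K x) 2) ∧ IsSchrodingerKernel ℓ f f' K := by
  have hq := memLp_logDeriv hf' hfc hf_ne
  obtain ⟨σ, hσm, hσ2, hσ, hσq⟩ : ∃ σ : ℝ → ℂ, StronglyMeasurable σ ∧ MemLp σ 2 ∧ Integrable σ ∧
      σ =ᵐ[volume.restrict (Ioo 0 ℓ)] fun x => f' x / f x := by
    have hmk := hq.ae_eq hq.1.ae_eq_mk
    refine ⟨(Ioo 0 ℓ).indicator (hq.1.mk _),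
      hq.1.stronglyMeasurable_mk.indicator measurableSet_Ioo,
      (memLp_indicator_iff_restrict measurableSet_Ioo).2 hmk,
      (integrable_indicator_iff measurableSet_Ioo).2 (hmk.integrable one_le_two), ?_⟩
    exact (indicator_ae_eq_restrict measurableSet_Ioo).trans hq.1.ae_eq_mk.symm
  obtain ⟨M, hK⟩ := exists_isIntegrableKernel_schrodingerKernel hσm hσ hσ2 ℓ
  refine ⟨schrodingerKernel σ, M, hK, memLp_two_schrodingerKernel_slice hσm hσ hσ2,
    ⟨memLp_two_schrodingerKernel_triangle hσm hσ hσ2 ℓ, fun x hx =>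
      (hK.integrable x (Ioc_subset_Icc_self hx)).intervalIntegrable⟩, fun ρ => ?_⟩
  have hsys := (isDiracSystem_expTransform hσm hσ hσ2 hℓ.le ρ).isSchrodingerSystem
  refine ⟨_, (isSchrodingerExp_iff hq hℓ).2 ⟨_, hsys.congr_coeff hσq⟩, fun x hx => ?_⟩
  rw [add_assoc, expTransform_evenKernel_add_oddKernel hσm hσ hσ2 ρ hx.1.le]

/-! ### The impedance kernel -/

section ImpedanceKernel

variable {ℓ : ℝ} {f f' : ℝ → ℂ}

theorem IsConeKernel.stronglyMeasurable_primitive {K : ℝ → ℝ → ℂ} (hK : IsConeKernel K) :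
    StronglyMeasurable (Function.uncurry fun x t => ∫ s in (-x)..t, K x s) := by
  have hKm : StronglyMeasurable (Function.uncurry fun (p : ℝ × ℝ) s => K p.1 s) :=
    hK.measurable.comp_measurable (g := fun q : (ℝ × ℝ) × ℝ => (q.1.1, q.2)) (by fun_prop)
  exact (stronglyMeasurable_setIntegral_Ioc hKm measurable_fst.neg measurable_snd).sub
    (stronglyMeasurable_setIntegral_Ioc hKm measurable_snd measurable_fst.neg)

theorem IsIntegrableKernel.norm_primitive_le {M : ℝ} {K : ℝ → ℝ → ℂ}
    (hK : IsIntegrableKernel ℓ M K) {x : ℝ} (hx : x ∈ Icc 0 ℓ) (t : ℝ) :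
    ‖∫ s in (-x)..t, K x s‖ ≤ M :=
  calc ‖∫ s in (-x)..t, K x s‖ ≤ ∫ s in uIoc (-x) t, ‖K x s‖ :=
        intervalIntegral.norm_integral_le_integral_norm_uIoc
    _ ≤ ∫ s, ‖K x s‖ := setIntegral_le_integral (hK.integrable x hx).norm
        (.of_forall fun _ => norm_nonneg _)
    _ ≤ M := hK.bound x hx

theorem isTriangleKernel_primitiveKernel (hf : ContinuousOn f (Icc 0 ℓ))
    (hf_ne : ∀ x ∈ Icc 0 ℓ, f x ≠ 0) {M : ℝ} {K : ℝ → ℝ → ℂ} (hK : IsIntegrableKernel ℓ M K) :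
    IsTriangleKernel ℓ (primitiveKernel f K) := by
  have hinv : ContinuousOn (fun x => 1 / f x) (Icc 0 ℓ) := continuousOn_const.div hf hf_ne
  obtain ⟨C, hC⟩ := isCompact_Icc.exists_bound_of_continuousOn hinv
  refine ⟨memLp_triangle_of_norm_le (C := C * M) (aestronglyMeasurable_triangle_div_mul hf hf_ne
    hK.stronglyMeasurable_primitive.aestronglyMeasurable) (fun p hp => ?_) 2, fun x hx => ?_⟩
  · have hp1 : p.1 ∈ Icc 0 ℓ := ⟨hp.1, hp.2.1⟩
    exact (norm_mul_le _ _).trans (mul_le_mul (hC _ hp1) (hK.norm_primitive_le hp1 p.2)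
      (norm_nonneg _) ((norm_nonneg _).trans (hC _ hp1)))
  · exact (isPrimitiveOn_primitiveKernel f hx.1.le (hK.integrable x
      (Ioc_subset_Icc_self hx)).intervalIntegrable).continuousOn_uIcc.intervalIntegrable

variable {K Kh : ℝ → ℝ → ℂ} (hℓ : 0 < ℓ) (hf : IsPrimitiveOn 0 ℓ f f')
  (hf' : MemLp f' 2 (volume.restrict (Ioo 0 ℓ))) (hf_ne : ∀ x ∈ Icc 0 ℓ, f x ≠ 0)
  (hf_zero : f 0 = 1)
include hℓ hf hf' hf_ne hf_zero

namespace IsSchrodingerKernel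

theorem ae_impedanceOp_eq (hK : IsSchrodingerKernel ℓ f f' K) (hKh : IsImpedanceKernel ℓ f Kh)
    {v v' : ℝ → ℂ} (hv : HasW12Deriv (-ℓ) ℓ v v') :
    ∀ᵐ x ∂volume.restrict (Ioo 0 ℓ), impedanceOp Kh v v' x = 1 / f x * schrodingerOp K v x := by
  obtain ⟨V, hV, hvV⟩ := hv.exists_isPrimitiveOn (neg_lt_self hℓ)
  have hvV₀ := ae_restrict_of_ae_restrict_of_subset
    (Ioo_subset_Ioo_left (Left.neg_nonpos_iff.2 hℓ.le)) hvV
  filter_upwards [hvV₀, ae_restrict_mem measurableSet_Ioo] with x hvx hx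
  exact hK.impedanceOp_eq hℓ hf hf' hf_ne hf_zero hKh (Ioo_subset_Ioc_self hx) hV hvV hvx

theorem eqOn_impedanceOp (hK : IsSchrodingerKernel ℓ f f' K) (hKh : IsImpedanceKernel ℓ f Kh)
    {v v' : ℝ → ℂ} (hv : HasW12Deriv (-ℓ) ℓ v v') (hvc : ContinuousOn v (Icc (-ℓ) ℓ)) {x : ℝ}
    (hx : x ∈ Icc 0 ℓ) : impedanceOp Kh v v' x = 1 / f x * schrodingerOp K v x := by
  rcases hx.1.eq_or_lt with rfl | hx0
  · simp [impedanceOp, schrodingerOp, hf_zero]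
  · exact hK.impedanceOp_eq hℓ hf hf' hf_ne hf_zero hKh ⟨hx0, hx.2⟩
      (hv.isPrimitiveOn (neg_lt_self hℓ) hvc) .rfl rfl

theorem memLp_two_slice (hK : IsSchrodingerKernel ℓ f f' K) {x : ℝ} (hx : x ∈ Ioc 0 ℓ) :
    MemLp (K x) 2 (volume.restrict (Ioo (-x) x)) := by
  obtain ⟨K₀, _, _, hK₀x, hK₀⟩ := exists_isSchrodingerKernel hℓ hf' hf.continuousOn hf_ne
  exact ((hK₀x x).restrict _).ae_eq (hK₀.ae_unique hℓ hf hf' hf_ne hf_zero hK hx)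

theorem hasW12Deriv_impedanceKernel (hK : IsSchrodingerKernel ℓ f f' K)
    (hKh : IsImpedanceKernel ℓ f Kh) {x : ℝ} (hx : x ∈ Ioc 0 ℓ) :
    HasW12Deriv (-x) x (Kh x) fun t => 1 / f x * K x t :=
  ((isPrimitiveOn_primitiveKernel f hx.1.le (hK.1.2 x hx)).hasW12Deriv
    ((hK.memLp_two_slice hℓ hf hf' hf_ne hf_zero hx).const_mul _)).congr
    (hK.ae_eq_primitiveKernel hℓ hf hf' hf_ne hf_zero hKh hx).symm

theorem ae_triangle_deriv_impedanceKernel_eq (hK : IsSchrodingerKernel ℓ f f' K)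
    (hKh : IsImpedanceKernel ℓ f Kh) {dKh : ℝ → ℝ → ℂ}
    (hdm : AEStronglyMeasurable (Function.uncurry dKh) (volume.restrict (triangle ℓ)))
    (hd : ∀ x ∈ Ioc 0 ℓ, HasW12Deriv (-x) x (Kh x) (dKh x)) :
    ∀ᵐ p ∂volume.restrict (triangle ℓ), dKh p.1 p.2 = 1 / f p.1 * K p.1 p.2 :=
  ae_triangle_eq_of_slices hdm
    (aestronglyMeasurable_triangle_div_mul hf.continuousOn hf_ne hK.1.1.aestronglyMeasurable)
    fun x hx => (hd x hx).ae_unique (neg_lt_self hx.1)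
      (hK.hasW12Deriv_impedanceKernel hℓ hf hf' hf_ne hf_zero hKh hx)

end IsSchrodingerKernel

end ImpedanceKernel

end Transmutation

open Transmutation in
theorem mainTheorem9 (ℓ : ℝ) (hℓ : 0 < ℓ) (f f' : ℝ → ℂ)
    (hf : HasW12Deriv 0 ℓ f f') (hfc : ContinuousOn f (Icc 0 ℓ))
    (hf_ne : ∀ x ∈ Icc 0 ℓ, f x ≠ 0) (hf_zero : f 0 = 1) :
    -- both kernels exist
    (∃ K : ℝ → ℝ → ℂ, IsSchrodingerKernel ℓ f f' K) ∧
    (∃ Kh : ℝ → ℝ → ℂ, IsImpedanceKernel ℓ f Kh) ∧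
    -- and any representatives of them have the following properties
    ∀ K Kh : ℝ → ℝ → ℂ, IsSchrodingerKernel ℓ f f' K → IsImpedanceKernel ℓ f Kh →
      -- (i) the two transmutation operators are related by division by `f`
      (∀ v v' : ℝ → ℂ, HasW12Deriv (-ℓ) ℓ v v' →
        (∀ᵐ x ∂(volume.restrict (Ioo 0 ℓ)),
          impedanceOp Kh v v' x = 1 / f x * schrodingerOp K v x) ∧
        (ContinuousOn v (Icc (-ℓ) ℓ) → ∀ x ∈ Icc 0 ℓ,
          impedanceOp Kh v v' x = 1 / f x * schrodingerOp K v x)) ∧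
      -- (ii) for each `x` the slice is in `W^{1,2}(-x,x)`, with `t`-derivative `K / f(x)`
      (∀ x ∈ Ioc 0 ℓ, HasW12Deriv (-x) x (Kh x) (fun t => 1 / f x * K x t)) ∧
      (∀ dKh : ℝ → ℝ → ℂ,
        AEStronglyMeasurable (Function.uncurry dKh) (volume.restrict (triangle ℓ)) →
        (∀ x ∈ Ioc 0 ℓ, HasW12Deriv (-x) x (Kh x) (dKh x)) →
        ∀ᵐ p ∂(volume.restrict (triangle ℓ)), dKh p.1 p.2 = 1 / f p.1 * K p.1 p.2) ∧
      -- (iii) Goursat conditions, for the continuous representative of each slice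
      (∀ x ∈ Ioc 0 ℓ, ∃ k : ℝ → ℂ, IsContinuousRep (-x) x (Kh x) k ∧
        k x = 1 - 1 / f x ∧ k (-x) = 0) := by
  have hf₀ := hf.isPrimitiveOn hℓ hfc
  have hf' := hf.memLp_deriv
  obtain ⟨K₀, M, hK₀int, -, hK₀⟩ := exists_isSchrodingerKernel hℓ hf' hfc hf_ne
  refine ⟨⟨K₀, hK₀⟩, ⟨_, hK₀.isImpedanceKernel_primitiveKernel hℓ hf₀ hf' hf_ne hf_zero
    (isTriangleKernel_primitiveKernel hfc hf_ne hK₀int)⟩, fun K Kh hK hKh => ⟨?_, ?_, ?_, ?_⟩⟩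
  · exact fun v v' hv => ⟨hK.ae_impedanceOp_eq hℓ hf₀ hf' hf_ne hf_zero hKh hv,
      fun hvc x hx => hK.eqOn_impedanceOp hℓ hf₀ hf' hf_ne hf_zero hKh hv hvc hx⟩
  · exact fun x hx => hK.hasW12Deriv_impedanceKernel hℓ hf₀ hf' hf_ne hf_zero hKh hx
  · exact fun dKh hdm hd =>
      hK.ae_triangle_deriv_impedanceKernel_eq hℓ hf₀ hf' hf_ne hf_zero hKh hdm hd
  · exact fun x hx =>
      ⟨_, hK.isContinuousRep_primitiveKernel hℓ hf₀ hf' hf_ne hf_zero hKh hx,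
        hK.primitiveKernel_self hℓ hf₀ hf' hf_ne hf_zero hx, primitiveKernel_neg f K x⟩
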